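/- For integers $n,k\ge 1$ and real $\varepsilon>0$, let $f(n,k,\varepsilon)$ be the minimum number $b$ of bits for which there are an encoding map, taking every sequence $(x_1,\dots,x_n)$ of points of Euclidean norm at most $1$ in $\mathbb{R}^k$ to a string in $\{0,1\}^b$, and a decoding map which, given this string and any two distinct indices $i\neq j$, returns two real numbers that differ from $\|x_i-x_j\|^2$ and from $\langle x_i,x_j\rangle$, respectively, by at most $\varepsilon$. Let $\log$ denote the natural logarithm. **Theorem.** There are absolute constants $c,C>0$ such that for all integers $n,k\ge 1$ and all real $\varepsilon$ with $\frac{1}{n^{0.49}}\le\varepsilon\le 0.1$ the following hold. 1. If $\frac{\log n}{\varepsilon^2}\le k\le n$, then $$c\,\frac{n\log n}{\varepsilon^2}\le f(n,k,\varepsilon)\le C\,\frac{n\log n}{\varepsilon^2}.$$ 2. If $\log n\le k\le \frac{\log n}{\varepsilon^2}$, then $$c\,nk\log\Big(2+\frac{\log n}{\varepsilon^2k}\Big)\le f(n,k,\varepsilon)\le C\,nk\log\Big(2+\frac{\log n}{\varepsilon^2k}\Big).$$ 3. If $1\le k\le\log n$, then $$c\,nk\log(1/\varepsilon)\le f(n,k,\varepsilon)\le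 C\,nk\log(1/\varepsilon).$$ -/

import Mathlib

/-- A sketching scheme with `b` bits for `n` labelled points `x 0, …, x (n-1)` of norm at most `1`
in Euclidean `k`-space: `enc` compresses the configuration to a string of `b` bits, and from
that string alone `dec` recovers, for any two of the points (given by their labels), an estimate
of their squared distance (first component) and of their inner product (second component),
each up to an additive error of `ε`. -/
def IsDistanceSketch (n k : ℕ) (ε : ℝ) (b : ℕ)
    (enc : (Fin n → EuclideanSpace ℝ (Fin k)) → (Fin b → Bool))
    (dec : (Fin b → Bool) → Fin n → Fin n → ℝ × ℝ) : Prop :=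
  ∀ x : Fin n → EuclideanSpace ℝ (Fin k), (∀ i, ‖x i‖ ≤ 1) →
    ∀ i j : Fin n, i ≠ j →
      |(dec (enc x) i j).1 - ‖x i - x j‖ ^ 2| ≤ ε ∧
      |(dec (enc x) i j).2 - inner ℝ (x i) (x j)| ≤ ε

/-- `f(n, k, ε)`: the minimum number of bits of an `ε`-distance sketch for `n` points of norm at
most `1` in Euclidean `k`-space. -/
noncomputable def sketchBits (n k : ℕ) (ε : ℝ) : ℕ :=
  sInf {b : ℕ | ∃ enc dec, IsDistanceSketch n k ε b enc dec}

/-! Lower bound: fix at most half of the points as anchors and let the others range over a finite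
set `X` whose elements are told apart by their inner products with the anchors, even with tolerance
`2ε`. A sketch must then remember a word over `X` (`IsDistanceSketch.card_pow_le`). In dimension
`d`, `5 ^ d` anchors determine norms up to a factor `2`, so any `4ε`-separated set can serve as `X`.
This needs `d` of order at most `log n`. For larger `k` the space is cut into `t` orthogonal blocks
of dimension `d` of order `log n`: the anchors number only `t * 5 ^ d`, while the product of `t`
packings of balls of radius `1/√t` still has logarithm at least `(t d / 2) log (1 / (16 ε² t))`
(`IsDistanceSketch.block_lower_bound`).

Upper bound: replace the points by points of a lattice `s ℤ^K` and store these
(`exists_sketch_of_lattice`); a coordinate costs about the logarithm of the ratio of its typical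
size `1/√K` to `s`. Rounding down coordinatewise needs `s` of order `ε/√k`, hence `log (1/ε)` per
coordinate, which suffices for `k ≤ log n`. Unbiased random rounding errs only by order `s √(log n)`
in each of `n` bounded directions, so `s` of order `ε/√(log n)` is enough, at a cost of order `log
(2 + log n/(ε² K))` per coordinate (`exists_lattice_configuration`). In high dimension a
Johnson–Lindenstrauss map (`exists_dimension_reduction`) first brings `K` down to order `log n/ε²`,
where this cost is constant. -/

open scoped NNReal ENNReal

/-! ### Lower bound: anchors, packings and blocks. -/

/-- Any real inner product space of dimension at most `k` embeds isometrically in `ℝ^k`. -/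
lemma exists_linearIsometry_euclideanSpace {E : Type*} [NormedAddCommGroup E]
    [InnerProductSpace ℝ E] [FiniteDimensional ℝ E] {k : ℕ} (h : Module.finrank ℝ E ≤ k) :
    Nonempty (E →ₗᵢ[ℝ] EuclideanSpace ℝ (Fin k)) := by
  let v := stdOrthonormalBasis ℝ E
  let w := EuclideanSpace.basisFun (Fin k) ℝ
  let f : E →ₗ[ℝ] EuclideanSpace ℝ (Fin k) :=
    v.toBasis.constr ℝ (fun i => w (Fin.castLE h i))
  have hf : f ∘ v.toBasis = fun i => w (Fin.castLE h i) := by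
    funext i
    simp [f]
  refine ⟨f.isometryOfOrthonormal (v := v.toBasis) ?_ ?_⟩
  · simp [v.orthonormal]
  · rw [hf]
    exact w.orthonormal.comp _ (Fin.castLE_injective h)

/-- If the vectors of `X` are told apart by their inner products with the vectors of `A`, then
a sketch of a configuration that contains `A` must store the other points as elements of `X`. -/
lemma IsDistanceSketch.card_pow_le {n k b : ℕ} {ε : ℝ}
    {enc : (Fin n → EuclideanSpace ℝ (Fin k)) → (Fin b → Bool)}
    {dec : (Fin b → Bool) → Fin n → Fin n → ℝ × ℝ} (hs : IsDistanceSketch n k ε b enc dec)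
    {E : Type*} [NormedAddCommGroup E] [InnerProductSpace ℝ E] [FiniteDimensional ℝ E]
    (hE : Module.finrank ℝ E ≤ k) (A X : Finset E) (hA : ∀ a ∈ A, ‖a‖ ≤ 1)
    (hX : ∀ x ∈ X, ‖x‖ ≤ 1) (hAn : A.card ≤ n)
    (hsep : ∀ x ∈ X, ∀ y ∈ X, (∀ a ∈ A, |inner ℝ a (x - y)| ≤ 2 * ε) → x = y) :
    X.card ^ (n - A.card) ≤ 2 ^ b := by
  obtain ⟨p, rfl⟩ := Nat.exists_eq_add_of_le hAn
  obtain ⟨T⟩ := exists_linearIsometry_euclideanSpace hE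
  let conf : (Fin p → X) → Fin (A.card + p) → EuclideanSpace ℝ (Fin k) := fun g =>
    Fin.append (fun i => T (A.equivFin.symm i)) (fun i => T (g i))
  have hconf : ∀ g i, ‖conf g i‖ ≤ 1 := by
    intro g i
    refine Fin.addCases (fun i => ?_) (fun i => ?_) i
    · simpa [conf] using hA _ (A.equivFin.symm i).2
    · simpa [conf] using hX _ (g i).2
  have hinj : Function.Injective (fun g => enc (conf g)) := by
    intro g g' hg
    funext q
    apply Subtype.ext
    refine hsep _ (g q).2 _ (g' q).2 fun a ha => ?_
    have hne : Fin.castAdd p (A.equivFin ⟨a, ha⟩) ≠ Fin.natAdd A.card q := by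
      intro h
      have := congrArg Fin.val h
      simp only [Fin.val_castAdd, Fin.val_natAdd] at this
      have := (A.equivFin ⟨a, ha⟩).2
      omega
    -- Equal codewords give one estimate that is within `ε` of both inner products with the anchor,
    -- so these differ by at most `2ε`.
    have h1 := (hs _ (hconf g) _ _ hne).2
    have h2 := (hs _ (hconf g') _ _ hne).2
    simp only at hg
    rw [hg] at h1
    simp only [conf, Fin.append_left, Fin.append_right, Equiv.symm_apply_apply,
      LinearIsometry.inner_map_map] at h1 h2
    rw [inner_sub_right, abs_le]
    rw [abs_le] at h1 h2
    constructor <;> linarith [h1.1, h1.2, h2.1, h2.2]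
  have := Fintype.card_le_of_injective _ hinj
  simpa using this

/-- A maximal separated subset of the ball is automatically a net, and compactness makes it finite.
Both properties are needed: the net gives packings by volume, the separation bounds the norming set.
-/
lemma exists_separated_cover {E : Type*} [NormedAddCommGroup E] [NormedSpace ℝ E]
    [FiniteDimensional ℝ E] (r : ℝ) {ρ : ℝ} (hρ : 0 < ρ) :
    ∃ S : Finset E, (∀ x ∈ S, ‖x‖ ≤ r) ∧ (∀ x ∈ S, ∀ y ∈ S, x ≠ y → ρ < ‖x - y‖) ∧
      ∀ x : E, ‖x‖ ≤ r → ∃ y ∈ S, ‖x - y‖ ≤ ρ := by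
  have : ProperSpace E := FiniteDimensional.proper ℝ E
  let δ : ℝ≥0 := ρ.toNNReal
  have hfin : Metric.packingNumber δ (Metric.closedBall (0 : E) r) ≠ ⊤ := by
    obtain ⟨N, -, hN, hcov⟩ := Metric.exists_finite_isCover_of_isCompact
      (ε := δ / 2) (by simpa [δ] using hρ) (isCompact_closedBall (0 : E) r)
    have h := Metric.packingNumber_two_mul_le_externalCoveringNumber (δ / 2)
      (Metric.closedBall (0 : E) r)
    rw [mul_div_cancel₀ δ two_ne_zero] at h
    exact ((h.trans hcov.externalCoveringNumber_le_encard).trans_lt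
      (Set.encard_lt_top_iff.2 hN)).ne
  have hfin' : (Metric.maximalSeparatedSet δ (Metric.closedBall (0 : E) r)).Finite := by
    rw [← Set.encard_ne_top_iff, Metric.encard_maximalSeparatedSet hfin]
    exact hfin
  have hed : ∀ x y : E, edist x y = ENNReal.ofReal ‖x - y‖ := fun x y => by
    rw [edist_dist, dist_eq_norm]
  have hδ : (δ : ℝ≥0∞) = ENNReal.ofReal ρ := rfl
  refine ⟨hfin'.toFinset, ?_, ?_, ?_⟩
  · intro x hx
    simpa using Metric.maximalSeparatedSet_subset (hfin'.mem_toFinset.1 hx)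
  · intro x hx y hy hxy
    have := Metric.isSeparated_maximalSeparatedSet (hfin'.mem_toFinset.1 hx)
      (hfin'.mem_toFinset.1 hy) hxy
    simp only [hed, hδ] at this
    exact (ENNReal.ofReal_lt_ofReal_iff_of_nonneg hρ.le).1 this
  · intro x hx
    obtain ⟨y, hy, hxy⟩ := Metric.isCover_maximalSeparatedSet hfin
      (show x ∈ Metric.closedBall (0 : E) r by simpa using hx)
    refine ⟨y, hfin'.mem_toFinset.2 hy, ?_⟩
    have hxy : edist x y ≤ δ := hxy
    rw [hed, hδ] at hxy
    exact (ENNReal.ofReal_le_ofReal_iff hρ.le).1 hxy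

/-- A large separated set in a ball. -/
lemma exists_packing {E : Type*} [NormedAddCommGroup E] [NormedSpace ℝ E]
    [FiniteDimensional ℝ E] {r ρ : ℝ} (hr : 0 ≤ r) (hρ : 0 < ρ) :
    ∃ S : Finset E, (∀ x ∈ S, ‖x‖ ≤ r) ∧ (∀ x ∈ S, ∀ y ∈ S, x ≠ y → ρ < ‖x - y‖) ∧
      (r / ρ) ^ Module.finrank ℝ E ≤ S.card := by
  obtain ⟨S, h1, h2, h3⟩ := exists_separated_cover (E := E) r hρ
  refine ⟨S, h1, h2, ?_⟩
  let : MeasurableSpace E := borel E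
  have : BorelSpace E := ⟨rfl⟩
  let μ : MeasureTheory.Measure E := MeasureTheory.Measure.addHaar
  have hsub : Metric.closedBall (0 : E) r ⊆ ⋃ y ∈ S, Metric.closedBall y ρ := by
    intro x hx
    obtain ⟨y, hy, hxy⟩ := h3 x (by simpa using hx)
    simp only [Set.mem_iUnion]
    exact ⟨y, hy, by simpa [dist_eq_norm] using hxy⟩
  -- Comparing volumes: the `ρ`-balls around the net cover the ball of radius `r`.
  have h := (MeasureTheory.measure_mono (μ := μ) hsub).trans
    (MeasureTheory.measure_biUnion_finset_le S _)
  simp only [MeasureTheory.Measure.addHaar_closedBall μ _ hr,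
    MeasureTheory.Measure.addHaar_closedBall μ _ hρ.le, Finset.sum_const, nsmul_eq_mul,
    ← mul_assoc] at h
  have hpos : μ (Metric.ball (0 : E) 1) ≠ 0 :=
    (Metric.measure_ball_pos μ _ one_pos).ne'
  have hlt : μ (Metric.ball (0 : E) 1) ≠ ⊤ := MeasureTheory.measure_ball_lt_top.ne
  rw [ENNReal.mul_le_mul_iff_left hpos hlt, ← ENNReal.ofReal_natCast,
    ← ENNReal.ofReal_mul (by positivity), ENNReal.ofReal_le_ofReal_iff (by positivity)] at h
  rw [div_pow, div_le_iff₀ (by positivity)]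
  exact h

/-- A finite set of at most `5 ^ d` unit vectors that determines norms up to a factor `2`. -/
lemma exists_norming_finset (E : Type*) [NormedAddCommGroup E] [InnerProductSpace ℝ E]
    [FiniteDimensional ℝ E] :
    ∃ N : Finset E, (∀ c ∈ N, ‖c‖ ≤ 1) ∧ N.card ≤ 5 ^ Module.finrank ℝ E ∧
      ∀ (z : E) (R : ℝ), 0 ≤ R → (∀ c ∈ N, |inner ℝ c z| ≤ R) → ‖z‖ ≤ 2 * R := by
  classical
  -- Radius `2` and separation `1` are the normalisation in which `Besicovitch.card_le_of_separated`
  -- gives `5 ^ d`; halving moves the set into the unit ball.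
  obtain ⟨S, h1, h2, h3⟩ := exists_separated_cover (E := E) 2 one_pos
  refine ⟨S.image (fun c => (1 / 2 : ℝ) • c), ?_, ?_, ?_⟩
  · intro c hc
    obtain ⟨c', hc', rfl⟩ := Finset.mem_image.1 hc
    rw [norm_smul]
    norm_num
    linarith [h1 c' hc']
  · exact Finset.card_image_le.trans
      (Besicovitch.card_le_of_separated S h1 fun c hc d hd h => (h2 c hc d hd h).le)
  · intro z R hR hz
    by_cases hz0 : z = 0
    · simpa [hz0] using hR
    have hzpos : 0 < ‖z‖ := norm_pos_iff.2 hz0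
    have hw : ‖(2 / ‖z‖) • z‖ = 2 := by
      rw [norm_smul, Real.norm_of_nonneg (by positivity)]
      field_simp
    obtain ⟨c, hc, hcz⟩ := h3 _ hw.le
    have h := hz _ (Finset.mem_image_of_mem _ hc)
    rw [inner_smul_left] at h
    have hexp := norm_sub_sq_real ((2 / ‖z‖) • z) c
    rw [hw, inner_smul_left, real_inner_comm] at hexp
    simp only [conj_trivial] at h hexp
    have hcn : 1 ≤ ‖c‖ := by
      have := norm_sub_norm_le ((2 / ‖z‖) • z) c
      rw [hw] at this
      linarith
    -- With `w` the rescaled vector of norm `2`, `1 ≥ ‖w - c‖² = 4 - 2⟨w, c⟩ + ‖c‖²` and `‖c‖ ≥ 1`.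
    have h5 : 2 ≤ 2 / ‖z‖ * inner ℝ c z := by nlinarith [norm_nonneg ((2 / ‖z‖) • z - c)]
    have h6 : ‖z‖ ≤ inner ℝ c z := by
      rw [div_mul_eq_mul_div, le_div_iff₀ hzpos] at h5
      linarith
    have h7 := (abs_le.1 h).2
    linarith

/-- Concatenating `t` blocks of dimension `d` gives a lower bound on the size of a sketch. -/
lemma IsDistanceSketch.block_lower_bound {n k b : ℕ} {ε : ℝ} (hε : 0 < ε)
    {enc : (Fin n → EuclideanSpace ℝ (Fin k)) → (Fin b → Bool)}
    {dec : (Fin b → Bool) → Fin n → Fin n → ℝ × ℝ} (hs : IsDistanceSketch n k ε b enc dec)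
    {d t : ℕ} (ht : 0 < t) (hdt : t * d ≤ k) (hn : 2 * (t * 5 ^ d) ≤ n)
    (hlog : 0 ≤ Real.log (1 / (16 * ε ^ 2 * t))) :
    (n * (t * d)) / 4 * Real.log (1 / (16 * ε ^ 2 * t)) ≤ b * Real.log 2 := by
  classical
  let B := EuclideanSpace ℝ (Fin d)
  let E := PiLp 2 (fun _ : Fin t => B)
  have htpos : (0 : ℝ) < t := by exact_mod_cast ht
  have hsq : 0 < √(t : ℝ) := Real.sqrt_pos.2 htpos
  obtain ⟨N, hN1, hN2, hN3⟩ := exists_norming_finset B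
  -- Radius `1/√t` keeps a concatenation of `t` blocks in the unit ball; `4ε` is the tolerance `2ε`
  -- times the loss `2` of the norming set.
  obtain ⟨P, hP1, hP2, hP3⟩ := exists_packing (E := B) (r := 1 / √t) (ρ := 4 * ε)
    (by positivity) (by positivity)
  have hdim : Module.finrank ℝ B = d := by simp [B]
  rw [hdim] at hN2 hP3
  let A : Finset E := (Finset.univ ×ˢ N).image fun p => PiLp.single 2 p.1 p.2
  let X : Finset E := (Fintype.piFinset fun _ : Fin t => P).image (WithLp.toLp 2)
  have hAcard : A.card ≤ t * 5 ^ d := by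
    refine Finset.card_image_le.trans ?_
    rw [Finset.card_product, Finset.card_univ, Fintype.card_fin]
    exact Nat.mul_le_mul_left _ hN2
  have hXcard : X.card = P.card ^ t := by
    rw [Finset.card_image_of_injective _ (WithLp.toLp_injective 2)]
    simp
  have hE : Module.finrank ℝ E ≤ k := by
    have : Module.finrank ℝ E = t * d := by
      rw [(WithLp.linearEquiv 2 ℝ (Fin t → B)).finrank_eq, Module.finrank_pi_fintype]
      simp [hdim]
    rwa [this]
  have hA : ∀ a ∈ A, ‖a‖ ≤ 1 := by
    intro a ha
    obtain ⟨p, hp, rfl⟩ := Finset.mem_image.1 ha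
    rw [PiLp.norm_single]
    exact hN1 _ (Finset.mem_product.1 hp).2
  have hX : ∀ x ∈ X, ‖x‖ ≤ 1 := by
    intro x hx
    obtain ⟨f, hf, rfl⟩ := Finset.mem_image.1 hx
    rw [← abs_of_nonneg (norm_nonneg _), ← sq_le_one_iff_abs_le_one, PiLp.norm_sq_eq_of_L2]
    calc ∑ i, ‖f i‖ ^ 2 ≤ ∑ _i : Fin t, (1 / √(t : ℝ)) ^ 2 :=
          Finset.sum_le_sum fun i _ => pow_le_pow_left₀ (norm_nonneg _)
            (hP1 _ (Fintype.mem_piFinset.1 hf i)) 2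
      _ = 1 := by
          rw [Finset.sum_const, Finset.card_univ, Fintype.card_fin, nsmul_eq_mul, div_pow,
            Real.sq_sqrt htpos.le]
          field_simp
  have hsep : ∀ x ∈ X, ∀ y ∈ X, (∀ a ∈ A, |inner ℝ a (x - y)| ≤ 2 * ε) → x = y := by
    intro x hx y hy h
    obtain ⟨f, hf, rfl⟩ := Finset.mem_image.1 hx
    obtain ⟨g, hg, rfl⟩ := Finset.mem_image.1 hy
    congr 1
    funext i
    by_contra hne
    have hlt := hP2 _ (Fintype.mem_piFinset.1 hf i) _ (Fintype.mem_piFinset.1 hg i) hne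
    have hle := hN3 (f i - g i) (2 * ε) (by positivity) fun c hc => by
      have := h (PiLp.single 2 i c)
        (Finset.mem_image.2 ⟨(i, c), Finset.mem_product.2 ⟨Finset.mem_univ _, hc⟩, rfl⟩)
      rw [PiLp.inner_apply, Finset.sum_eq_single i] at this
      · rw [PiLp.single_eq_same] at this
        exact this
      · intro j _ hj
        simp [hj]
      · simp
    linarith
  have hmain := hs.card_pow_le hE A X hA hX (by omega) hsep
  have hPlog : (d : ℝ) / 2 * Real.log (1 / (16 * ε ^ 2 * t)) ≤ Real.log P.card := by
    have h1 : (d : ℝ) / 2 * Real.log (1 / (16 * ε ^ 2 * t)) =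
        Real.log ((1 / √t / (4 * ε)) ^ d) := by
      have : 1 / (16 * ε ^ 2 * t) = (1 / √t / (4 * ε)) ^ 2 := by
        rw [div_pow, div_pow, Real.sq_sqrt htpos.le]
        field_simp
        norm_num
      rw [this, Real.log_pow, Real.log_pow]
      push_cast
      ring
    rw [h1]
    exact Real.log_le_log (by positivity) hP3
  have hlog2 : ((n - A.card : ℕ) : ℝ) * (t * Real.log P.card) ≤ b * Real.log 2 := by
    have hPpos : 0 < P.card := by
      have : (0 : ℝ) < P.card := lt_of_lt_of_le (by positivity) hP3
      exact_mod_cast this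
    rw [hXcard] at hmain
    rw [← Real.log_pow, ← Real.log_pow, ← Real.log_pow]
    exact Real.log_le_log (by positivity) (by exact_mod_cast hmain)
  have hhalf : (n : ℝ) / 2 ≤ ((n - A.card : ℕ) : ℝ) := by
    rw [Nat.cast_sub (by omega)]
    have : 2 * (A.card : ℝ) ≤ n := by exact_mod_cast (by omega : 2 * A.card ≤ n)
    linarith
  calc (n * (t * d)) / 4 * Real.log (1 / (16 * ε ^ 2 * t))
      = n / 2 * (t * (d / 2 * Real.log (1 / (16 * ε ^ 2 * t)))) := by ring
    _ ≤ ((n - A.card : ℕ) : ℝ) * (t * Real.log P.card) := by gcongr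
    _ ≤ _ := hlog2

/-! ### Lower bound: choice of block size and number of blocks. -/

lemma hundred_le_of_accuracy {n : ℕ} {ε : ℝ} (hn : 1 ≤ n)
    (h1 : 1 / (n : ℝ) ^ (0.49 : ℝ) ≤ ε) (h2 : ε ≤ 0.1) : (100 : ℝ) ≤ n := by
  have hn1 : (1 : ℝ) ≤ n := by exact_mod_cast hn
  have hpos : (0 : ℝ) < (n : ℝ) ^ (0.49 : ℝ) := by positivity
  have h3 : 1 / (n : ℝ) ^ (0.49 : ℝ) ≤ 0.1 := h1.trans h2
  rw [div_le_iff₀ hpos] at h3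
  have h4 : (n : ℝ) ^ (0.49 : ℝ) ≤ √n := by
    rw [Real.sqrt_eq_rpow]
    exact Real.rpow_le_rpow_of_exponent_le hn1 (by norm_num)
  have h5 : 10 ≤ √(n : ℝ) := by linarith
  nlinarith [Real.sq_sqrt (show (0 : ℝ) ≤ n by linarith)]

lemma four_le_log {x : ℝ} (hx : 100 ≤ x) : 4 ≤ Real.log x := by
  rw [Real.le_log_iff_exp_le (by linarith)]
  have h : Real.exp 4 = Real.exp 1 ^ 4 := by rw [← Real.exp_nat_mul]; norm_num
  have h1 := Real.exp_one_lt_d9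
  have h0 := Real.exp_pos 1
  have h2 : Real.exp 1 ^ 4 ≤ 2.7182818286 ^ 4 := pow_le_pow_left₀ h0.le h1.le 4
  rw [h]
  refine h2.trans (le_trans ?_ hx)
  norm_num

lemma one_div_sq_le_of_accuracy {n : ℕ} {ε : ℝ} (hn : 1 ≤ n)
    (h1 : 1 / (n : ℝ) ^ (0.49 : ℝ) ≤ ε) : 1 / ε ^ 2 ≤ (n : ℝ) ^ (0.98 : ℝ) := by
  have hn1 : (1 : ℝ) ≤ n := by exact_mod_cast hn
  have hpos : (0 : ℝ) < (n : ℝ) ^ (0.49 : ℝ) := by positivity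
  have hε : 0 < ε := lt_of_lt_of_le (by positivity) h1
  have h2 : (n : ℝ) ^ (0.98 : ℝ) = ((n : ℝ) ^ (0.49 : ℝ)) ^ 2 := by
    rw [← Real.rpow_natCast, ← Real.rpow_mul (by positivity)]
    norm_num
  have h3 : 1 / ε ≤ (n : ℝ) ^ (0.49 : ℝ) := by
    rw [div_le_iff₀ hpos] at h1
    rw [div_le_iff₀ hε]
    linarith
  rw [h2, ← one_div_pow]
  exact pow_le_pow_left₀ (by positivity) h3 2

lemma five_pow_le {n : ℝ} (hn : 0 < n) {d : ℕ} {a : ℝ} (hd : d ≤ a * Real.log n) :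
    (5 : ℝ) ^ d ≤ n ^ (2 * a) := by
  have h5 : (5 : ℝ) ≤ Real.exp 2 := by
    have h : Real.exp 2 = Real.exp 1 ^ 2 := by rw [← Real.exp_nat_mul]; norm_num
    have := Real.exp_one_gt_d9
    rw [h]
    nlinarith
  calc (5 : ℝ) ^ d ≤ Real.exp 2 ^ d := by gcongr
    _ = Real.exp (2 * d) := by rw [← Real.exp_nat_mul, mul_comm]
    _ ≤ Real.exp (Real.log n * (2 * a)) := Real.exp_le_exp.2 (by linarith)
    _ = n ^ (2 * a) := (Real.rpow_def_of_pos hn _).symm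

/-- Absorbs the factor `16` of the block bound into a constant multiple of the logarithm. -/
lemma log_le_four_mul_log_div {M : ℝ} (hM : 100 ≤ M) :
    Real.log (3 * M) ≤ 4 * Real.log (M / 16) := by
  have h : 4 * Real.log (M / 16) = Real.log ((M / 16) ^ 4) := by
    rw [Real.log_pow]; norm_num
  rw [h]
  refine Real.log_le_log (by linarith) ?_
  have : (100 : ℝ) ^ 3 ≤ M ^ 3 := pow_le_pow_left₀ (by norm_num) hM 3
  nlinarith

lemma hundred_le_one_div_sq {ε : ℝ} (h0 : 0 < ε) (h : ε ≤ 0.1) : 100 ≤ 1 / ε ^ 2 := by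
  rw [le_div_iff₀ (by positivity)]
  nlinarith

lemma IsDistanceSketch.lower_bound_low_dim {n k b : ℕ} {ε : ℝ} (hn : (100 : ℝ) ≤ n) (hk : 1 ≤ k)
    (h0 : 0 < ε) (hε : ε ≤ 0.1)
    {enc : (Fin n → EuclideanSpace ℝ (Fin k)) → (Fin b → Bool)}
    {dec : (Fin b → Bool) → Fin n → Fin n → ℝ × ℝ} (hs : IsDistanceSketch n k ε b enc dec)
    (hkn : k ≤ Real.log n) : 1 / 64 * (n * k * Real.log (1 / ε)) ≤ b := by
  have hM := hundred_le_one_div_sq h0 hε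
  have hMM : 1 / (16 * ε ^ 2 * ((1 : ℕ) : ℝ)) = 1 / ε ^ 2 / 16 := by
    push_cast
    field_simp
  have hlog := log_le_four_mul_log_div hM
  have hlog1 : Real.log (1 / ε ^ 2) = 2 * Real.log (1 / ε) := by
    rw [← one_div_pow, Real.log_pow]; norm_num
  have hlog2 : Real.log (1 / ε ^ 2) ≤ Real.log (3 * (1 / ε ^ 2)) :=
    Real.log_le_log (by positivity) (by linarith)
  have hlog0 : 0 ≤ Real.log (1 / ε) := Real.log_nonneg (by rw [le_div_iff₀ h0]; linarith)
  -- A single block suffices here. Dimension about `k/4` keeps the number of anchors below `√n`; for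
  -- `k < 8` one dimension will do.
  obtain ⟨d, hd1, hdk, hkd, hdn⟩ : ∃ d : ℕ, 1 ≤ d ∧ d ≤ k ∧ k ≤ 8 * d ∧ 2 * 5 ^ d ≤ n := by
    by_cases hk4 : k < 8
    · exact ⟨1, le_rfl, hk, by omega, by
        have : (10 : ℝ) ≤ n := by linarith
        exact_mod_cast this⟩
    · refine ⟨k / 4, by omega, by omega, by omega, ?_⟩
      have h1 : ((k / 4 : ℕ) : ℝ) ≤ 1 / 4 * Real.log n :=
        Nat.cast_div_le.trans (by push_cast; linarith)
      have h2 := five_pow_le (by linarith) h1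
      have h3 : (n : ℝ) ^ (2 * (1 / 4) : ℝ) = √n := by
        rw [Real.sqrt_eq_rpow]; norm_num
      rw [h3] at h2
      have h4 : 2 * √(n : ℝ) ≤ n := by
        have h5 : 10 ≤ √(n : ℝ) := Real.le_sqrt_of_sq_le (by linarith)
        nlinarith [Real.sq_sqrt (show (0 : ℝ) ≤ n by linarith)]
      have h5 : (2 : ℝ) * 5 ^ (k / 4) ≤ n := by linarith
      exact_mod_cast h5
  have hmain := hs.block_lower_bound h0 (d := d) (t := 1) one_pos (by omega) (by omega)
    (by rw [hMM]; linarith)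
  rw [hMM] at hmain
  have hb : (b : ℝ) * Real.log 2 ≤ b :=
    mul_le_of_le_one_right (Nat.cast_nonneg _) (by linarith [Real.log_two_lt_d9])
  have hkd' : (k : ℝ) / 8 ≤ d := by
    have : (k : ℝ) ≤ 8 * d := by exact_mod_cast hkd
    linarith
  refine le_trans ?_ (hmain.trans hb)
  calc 1 / 64 * (n * k * Real.log (1 / ε))
      = n * (k / 8) / 4 * (Real.log (1 / ε) / 2) := by ring
    _ ≤ n * (((1 : ℕ) : ℝ) * d) / 4 * Real.log (1 / ε ^ 2 / 16) := by
      rw [Nat.cast_one, one_mul]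
      gcongr
      linarith

/-- The real parameter `κ` is the part of the dimension that is exploited. Taking `κ = k` serves the
intermediate range and `κ = log n/ε²` all larger dimensions. -/
lemma IsDistanceSketch.lower_bound_high_dim {n k b : ℕ} {ε κ : ℝ} (hn1 : 1 ≤ n)
    (hnε : 1 / (n : ℝ) ^ (0.49 : ℝ) ≤ ε) (hε : ε ≤ 0.1)
    {enc : (Fin n → EuclideanSpace ℝ (Fin k)) → (Fin b → Bool)}
    {dec : (Fin b → Bool) → Fin n → Fin n → ℝ × ℝ} (hs : IsDistanceSketch n k ε b enc dec)
    (hκ1 : Real.log n ≤ κ) (hκ2 : κ ≤ Real.log n / ε ^ 2) (hκk : κ ≤ k) :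
    1 / 409600 * (n * κ * Real.log (2 + Real.log n / (ε ^ 2 * κ))) ≤ b := by
  have hn := hundred_le_of_accuracy hn1 hnε hε
  have hn0 : (0 : ℝ) < n := by linarith
  have h0 : 0 < ε := lt_of_lt_of_le (by positivity) hnε
  have hM := hundred_le_one_div_sq h0 hε
  have hMn := one_div_sq_le_of_accuracy hn1 hnε
  have hl := four_le_log hn
  have hl0 : 0 < Real.log n := by linarith
  have hκ0 : 0 < κ := by linarith
  set l := Real.log n with hldef
  set M := 1 / ε ^ 2 with hMdef
  set L := l / (ε ^ 2 * κ) with hLdef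
  have hLM : L = M * l / κ := by rw [hLdef, hMdef]; field_simp
  have hκM : κ ≤ M * l := by rw [hMdef, one_div_mul_eq_div]; exact hκ2
  have hL1 : 1 ≤ L := by rw [hLM, le_div_iff₀ hκ0]; linarith
  have hL2 : L ≤ M := by
    rw [hLM, div_le_iff₀ hκ0]
    gcongr
  -- Blocks of dimension `log n/200` need about `n ^ 0.01` anchors each. With `τ` blocks, `M/(16τ) =
  -- 4L`, so the logarithm in the block bound matches the target.
  set d := ⌈l / 200⌉₊ with hd
  set τ := κ / (64 * l) with hτ
  have hτ0 : 0 < τ := by positivity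
  have hκτ : κ = 64 * l * τ := by rw [hτ]; field_simp
  have hd1 : l / 200 ≤ d := Nat.le_ceil _
  have hd2 : (d : ℝ) < l / 200 + 1 := Nat.ceil_lt_add_one (by positivity)
  have hdl : (d : ℝ) ≤ l := by linarith
  have h5d : (5 : ℝ) ^ d ≤ 5 * (n : ℝ) ^ (0.01 : ℝ) := by
    have hdpos : 0 < d := Nat.ceil_pos.2 (by positivity)
    obtain ⟨d', hd'⟩ := Nat.exists_eq_succ_of_ne_zero hdpos.ne'
    have : (d' : ℝ) ≤ 1 / 200 * Real.log n := by
      rw [hd'] at hd2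
      push_cast at hd2
      linarith
    have h := five_pow_le hn0 this
    norm_num at h
    rw [hd', pow_succ]
    norm_num
    linarith
  -- The assumption `ε ≥ n ^ (-0.49)` enters here: at most order `1/ε² ≤ n ^ 0.98` blocks, with
  -- order `n ^ 0.01` anchors each, fit among `n` points.
  have hn99 : (n : ℝ) ^ (0.98 : ℝ) * (n : ℝ) ^ (0.01 : ℝ) ≤ n := by
    rw [← Real.rpow_add hn0]
    calc (n : ℝ) ^ (0.98 + 0.01 : ℝ) ≤ (n : ℝ) ^ (1 : ℝ) :=
          Real.rpow_le_rpow_of_exponent_le (by linarith) (by norm_num)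
      _ = n := Real.rpow_one _
  have hn01 : 0 < (n : ℝ) ^ (0.01 : ℝ) := by positivity
  -- `t` is `⌊τ⌋₊`, but at least one block.
  obtain ⟨t, ht0, ht1, ht2⟩ : ∃ t : ℕ, 0 < t ∧ τ / 2 ≤ t ∧ (t = 1 ∨ (t : ℝ) ≤ τ) := by
    by_cases h : τ < 1
    · exact ⟨1, one_pos, by push_cast; linarith, Or.inl rfl⟩
    · push Not at h
      have h1 : 1 ≤ ⌊τ⌋₊ := Nat.one_le_floor_iff τ |>.2 h
      refine ⟨⌊τ⌋₊, h1, ?_, Or.inr (Nat.floor_le hτ0.le)⟩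
      have h2 := Nat.lt_floor_add_one τ
      have h3 : (1 : ℝ) ≤ ⌊τ⌋₊ := by exact_mod_cast h1
      linarith
  have htpos : (0 : ℝ) < t := by exact_mod_cast ht0
  have htd : (t : ℝ) * d ≤ k := by
    refine le_trans ?_ hκk
    rcases ht2 with rfl | ht2
    · push_cast; linarith
    · calc (t : ℝ) * d ≤ τ * l := by gcongr
        _ ≤ κ := by rw [hκτ]; nlinarith [mul_pos hτ0 hl0]
  have hτM : τ ≤ M / 64 := by
    rw [hτ, div_le_div_iff₀ (by positivity) (by positivity)]
    linarith
  have hcard : 2 * ((t : ℝ) * 5 ^ d) ≤ n := by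
    rcases ht2 with rfl | ht2
    · have h98 : 10 ≤ (n : ℝ) ^ (0.98 : ℝ) := by linarith
      push_cast
      nlinarith
    · calc 2 * ((t : ℝ) * 5 ^ d) ≤ 2 * ((M / 64) * (5 * (n : ℝ) ^ (0.01 : ℝ))) := by
            gcongr
            exact ht2.trans hτM
        _ = M * (n : ℝ) ^ (0.01 : ℝ) * (10 / 64) := by ring
        _ ≤ ((n : ℝ) ^ (0.98 : ℝ) * (n : ℝ) ^ (0.01 : ℝ)) * 1 := by
            gcongr
            norm_num
        _ ≤ n := by linarith
  have hval : 1 / (16 * ε ^ 2 * t) = M / (16 * t) := by rw [hMdef]; field_simp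
  have hlog : Real.log (2 + L) ≤ 4 * Real.log (1 / (16 * ε ^ 2 * t)) := by
    rw [hval]
    rcases ht2 with rfl | ht2
    · have := log_le_four_mul_log_div hM
      rw [Nat.cast_one, mul_one]
      refine le_trans (Real.log_le_log (by linarith) ?_) this
      linarith
    · have h1 : 4 * L ≤ M / (16 * t) := by
        have : M / (16 * τ) = 4 * L := by
          rw [hτ, hLM]; field_simp; norm_num
        rw [← this]
        gcongr
      have h2 : Real.log (2 + L) ≤ Real.log (M / (16 * t)) :=
        Real.log_le_log (by linarith) (by linarith)
      have h3 : 0 ≤ Real.log (2 + L) := Real.log_nonneg (by linarith)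
      linarith
  have hlog0 : 0 ≤ Real.log (2 + L) := Real.log_nonneg (by linarith)
  have hmain := hs.block_lower_bound h0 (d := d) (t := t) ht0 (by exact_mod_cast htd)
    (by exact_mod_cast hcard) (by linarith)
  have hb : (b : ℝ) * Real.log 2 ≤ b :=
    mul_le_of_le_one_right (Nat.cast_nonneg _) (by linarith [Real.log_two_lt_d9])
  refine le_trans ?_ (hmain.trans hb)
  calc 1 / 409600 * (n * κ * Real.log (2 + L))
      = n * (τ / 2 * (l / 200)) / 4 * (Real.log (2 + L) / 4) := by rw [hκτ]; ring
    _ ≤ n * (t * d) / 4 * Real.log (1 / (16 * ε ^ 2 * t)) := by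
      gcongr
      linarith

/-! ### Upper bound: counting lattice points and storing them. -/

/-- The number of integer points in an `ℓ¹` ball. -/
lemma exists_finset_lattice_points (K : ℕ) {α : ℝ} (hα : 0 < α) :
    ∃ T : Finset (Fin K → ℤ), (∀ u : Fin K → ℤ, ∑ l, |(u l : ℝ)| ≤ α * K → u ∈ T) ∧
      (T.card : ℝ) ≤ (Real.exp 1 * (1 + 2 * α)) ^ K := by
  classical
  -- Generating-function bound: give `u` the weight `r ^ ‖u‖₁`. Points of the `ℓ¹` ball have weight
  -- at least `exp (-K)`, while the total weight factors over coordinates into `((1 + r)/(1 - r)) ^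
  -- K`.
  set r := Real.exp (-(1 / α)) with hr
  have hr0 : 0 < r := Real.exp_pos _
  have hr1 : r < 1 := by
    rw [hr, Real.exp_lt_one_iff]
    linarith [one_div_pos.2 hα]
  have hrα : r * (1 + α) ≤ α := by
    have h1 : 1 / α + 1 ≤ Real.exp (1 / α) := Real.add_one_le_exp _
    have h2 : r * Real.exp (1 / α) = 1 := by rw [hr, ← Real.exp_add]; simp
    have h3 : r * (1 / α + 1) ≤ 1 := (mul_le_mul_of_nonneg_left h1 hr0.le).trans h2.le
    have h4 : r * (1 / α + 1) * α = r * (1 + α) := by field_simp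
    nlinarith
  have hgeo : HasSum (fun j : ℤ => r ^ j.natAbs) ((1 - r)⁻¹ + r * (1 - r)⁻¹) := by
    refine HasSum.of_nat_of_neg_add_one ?_ ?_
    · simpa using hasSum_geometric_of_lt_one hr0.le hr1
    · have h : ∀ m : ℕ, (-((m : ℤ) + 1)).natAbs = m + 1 := fun m => by omega
      simpa only [h, pow_succ'] using (hasSum_geometric_of_lt_one hr0.le hr1).mul_left r
  have hgeo1 : (1 - r)⁻¹ + r * (1 - r)⁻¹ ≤ 1 + 2 * α := by
    have : (1 - r)⁻¹ + r * (1 - r)⁻¹ = (1 + r) / (1 - r) := by field_simp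
    rw [this, div_le_iff₀ (by linarith)]
    nlinarith
  let m : ℤ := ⌈α * K⌉
  let Box : Finset (Fin K → ℤ) := Fintype.piFinset fun _ => Finset.Icc (-m) m
  let T := Box.filter fun u => ∑ l, |(u l : ℝ)| ≤ α * K
  refine ⟨T, fun u hu => ?_, ?_⟩
  · refine Finset.mem_filter.2 ⟨Fintype.mem_piFinset.2 fun l => ?_, hu⟩
    rw [Finset.mem_Icc, ← abs_le]
    have h1 : |(u l : ℝ)| ≤ α * K :=
      (Finset.single_le_sum (f := fun l => |(u l : ℝ)|) (fun _ _ => abs_nonneg _)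
        (Finset.mem_univ l)).trans hu
    have h2 : ((|u l| : ℤ) : ℝ) ≤ m := by
      push_cast
      exact h1.trans (Int.le_ceil _)
    exact_mod_cast h2
  · have hweight : ∀ u ∈ T, Real.exp (-K) ≤ ∏ l, r ^ (u l).natAbs := by
      intro u hu
      have hu2 := (Finset.mem_filter.1 hu).2
      have : ∏ l, r ^ (u l).natAbs = Real.exp (-(1 / α) * ∑ l, |(u l : ℝ)|) := by
        rw [Finset.mul_sum, Real.exp_sum]
        refine Finset.prod_congr rfl fun l _ => ?_
        rw [hr, ← Real.exp_nat_mul, mul_comm, Nat.cast_natAbs, Int.cast_abs]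
      rw [this]
      refine Real.exp_le_exp.2 ?_
      rw [neg_mul, neg_le_neg_iff, one_div_mul_eq_div, div_le_iff₀ hα]
      linarith
    have h1 : (T.card : ℝ) * Real.exp (-K) ≤ (1 + 2 * α) ^ K := by
      calc (T.card : ℝ) * Real.exp (-K) = ∑ _u ∈ T, Real.exp (-K) := by simp
        _ ≤ ∑ u ∈ T, ∏ l, r ^ (u l).natAbs := Finset.sum_le_sum hweight
        _ ≤ ∑ u ∈ Box, ∏ l, r ^ (u l).natAbs :=
            Finset.sum_le_sum_of_subset_of_nonneg (Finset.filter_subset _ _)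
              fun _ _ _ => by positivity
        _ = ∏ _l : Fin K, ∑ j ∈ Finset.Icc (-m) m, r ^ j.natAbs :=
            (Finset.prod_univ_sum (fun _ => Finset.Icc (-m) m) fun _ j => r ^ j.natAbs).symm
        _ = (∑ j ∈ Finset.Icc (-m) m, r ^ j.natAbs) ^ K := by simp
        _ ≤ (1 + 2 * α) ^ K := by
            gcongr
            exact (sum_le_hasSum _ (fun _ _ => by positivity) hgeo).trans hgeo1
    have h2 : Real.exp (-K) * Real.exp 1 ^ K = 1 := by
      rw [← Real.exp_nat_mul, ← Real.exp_add]; simp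
    calc (T.card : ℝ) = (T.card : ℝ) * Real.exp (-K) * Real.exp 1 ^ K := by
          rw [mul_assoc, h2, mul_one]
      _ ≤ (1 + 2 * α) ^ K * Real.exp 1 ^ K := by gcongr
      _ = _ := by rw [mul_pow, mul_comm]

/-- If configurations can be replaced by integer points of small `ℓ¹` norm that preserve the inner
products of distinct points, then there is a short sketch. -/
lemma exists_sketch_of_lattice {n k K : ℕ} {ε σ α : ℝ} (hε : 0 < ε) (hα : 0 < α)
    (h : ∀ x : Fin n → EuclideanSpace ℝ (Fin k), (∀ i, ‖x i‖ ≤ 1) →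
      ∃ u : Fin n → Fin K → ℤ, (∀ i, ∑ l, |(u i l : ℝ)| ≤ α * K) ∧
        ∀ i j, i ≠ j → |σ * ∑ l, (u i l : ℝ) * u j l - inner ℝ (x i) (x j)| ≤ ε / 4) :
    ∃ b enc dec, IsDistanceSketch n k ε b enc dec ∧
      (b : ℝ) ≤ n * (K * Real.log (Real.exp 1 * (1 + 2 * α)) + Real.log (1 + 4 / ε)) /
        Real.log 2 + 1 := by
  classical
  obtain ⟨T, hT, hTcard⟩ := exists_finset_lattice_points K hα
  choose! u hu1 hu2 using h
  set N := ⌊4 / ε⌋₊ with hN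
  -- The squared norm is stored separately in units of `ε/4`, since the lattice points are not
  -- required to preserve the diagonal inner products. The distance estimate then errs by at most
  -- `ε/4 + ε/4 + 2 * (ε/4) = ε`.
  let C := T × Fin (N + 1)
  have hTne : (0 : Fin K → ℤ) ∈ T := hT 0 (by simp; positivity)
  have hTpos : 0 < T.card := Finset.card_pos.2 ⟨_, hTne⟩
  have : Nonempty C := ⟨(⟨0, hTne⟩, 0)⟩
  have hC : Fintype.card C = T.card * (N + 1) := by simp [C]
  set b := ⌈Real.log ((Fintype.card C : ℝ) ^ n) / Real.log 2⌉₊ with hb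
  have hlog2 : 0 < Real.log 2 := Real.log_pos one_lt_two
  have hCpos : (1 : ℝ) ≤ Fintype.card C := by exact_mod_cast Fintype.card_pos
  have hcard : Fintype.card (Fin n → C) ≤ Fintype.card (Fin b → Bool) := by
    simp only [Fintype.card_fun, Fintype.card_fin, Fintype.card_bool]
    have h1 : Real.log ((Fintype.card C : ℝ) ^ n) ≤ Real.log ((2 : ℝ) ^ b) := by
      rw [Real.log_pow 2, ← div_le_iff₀ hlog2]
      exact Nat.le_ceil _
    have h2 := (Real.log_le_log_iff (by positivity) (by positivity)).1 h1
    exact_mod_cast h2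
  obtain ⟨J⟩ := Function.Embedding.nonempty_of_card_le hcard
  let q : EuclideanSpace ℝ (Fin k) → Fin (N + 1) := fun y =>
    Fin.ofNat (N + 1) ⌊‖y‖ ^ 2 / (ε / 4)⌋₊
  have hq : ∀ y, ‖y‖ ≤ 1 → ((q y : ℕ) : ℝ) * (ε / 4) ≤ ‖y‖ ^ 2 ∧
      ‖y‖ ^ 2 ≤ ((q y : ℕ) : ℝ) * (ε / 4) + ε / 4 := by
    intro y hy
    have hle : ‖y‖ ^ 2 / (ε / 4) ≤ 4 / ε := by
      have : ‖y‖ ^ 2 ≤ 1 := pow_le_one₀ (norm_nonneg _) hy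
      rw [div_div_eq_mul_div, mul_comm]
      gcongr
      linarith
    have hv : ((q y : ℕ)) = ⌊‖y‖ ^ 2 / (ε / 4)⌋₊ := by
      simp only [q, Fin.ofNat]
      exact Nat.mod_eq_of_lt (Nat.lt_succ_of_le (Nat.floor_le_floor hle))
    rw [hv]
    have h1 := Nat.floor_le (show 0 ≤ ‖y‖ ^ 2 / (ε / 4) by positivity)
    have h2 := (Nat.lt_floor_add_one (‖y‖ ^ 2 / (ε / 4))).le
    rw [le_div_iff₀ (by positivity)] at h1
    rw [div_le_iff₀ (by positivity)] at h2
    exact ⟨h1, by linarith⟩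
  let code : (Fin n → EuclideanSpace ℝ (Fin k)) → Fin n → C := fun x i =>
    (if hm : u x i ∈ T then ⟨u x i, hm⟩ else ⟨0, hTne⟩, q (x i))
  let ip : C → C → ℝ := fun c d => σ * ∑ l, (c.1.1 l : ℝ) * d.1.1 l
  refine ⟨b, fun x => J (code x), fun w i j =>
    let c := Function.invFun J w
    (((c i).2 : ℕ) * (ε / 4) + ((c j).2 : ℕ) * (ε / 4) - 2 * ip (c i) (c j), ip (c i) (c j)),
    ?_, ?_⟩
  · intro x hx i j hij
    have hinv : Function.invFun J (J (code x)) = code x :=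
      Function.leftInverse_invFun J.injective _
    simp only [hinv]
    have hcode : ∀ i, (code x i).1.1 = u x i := fun i => by
      simp only [code, dif_pos (hT _ (hu1 x hx i))]
    have hip : |ip (code x i) (code x j) - inner ℝ (x i) (x j)| ≤ ε / 4 := by
      simp only [ip, hcode]
      exact hu2 x hx i j hij
    refine ⟨?_, hip.trans (by linarith)⟩
    rw [norm_sub_sq_real, abs_le]
    rw [abs_le] at hip
    have h1 := hq _ (hx i)
    have h2 := hq _ (hx j)
    have h3 : (code x i).2 = q (x i) := rfl
    have h4 : (code x j).2 = q (x j) := rfl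
    rw [h3, h4]
    constructor <;> linarith [h1.1, h1.2, h2.1, h2.2, hip.1, hip.2]
  · refine (Nat.ceil_lt_add_one ?_).le.trans ?_
    · exact div_nonneg (Real.log_nonneg (one_le_pow₀ hCpos)) hlog2.le
    · gcongr
      rw [Real.log_pow, hC]
      have hNle : (N : ℝ) ≤ 4 / ε := Nat.floor_le (by positivity)
      have hTpos' : (0 : ℝ) < T.card := by exact_mod_cast hTpos
      push_cast
      rw [Real.log_mul (by positivity) (by positivity), ← Real.log_pow]
      have hN1 : Real.log (N + 1) ≤ Real.log (1 + 4 / ε) :=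
        Real.log_le_log (by positivity) (by linarith)
      gcongr

/-! ### Upper bound: derandomised rounding. -/

/-- The linear term vanishes on averaging a centred variable, leaving a subgaussian bound. -/
lemma exp_le_add_exp_sq (x : ℝ) : Real.exp x ≤ x + Real.exp (x ^ 2) := by
  have h1 : x ^ 2 + 1 ≤ Real.exp (x ^ 2) := Real.add_one_le_exp _
  rcases le_or_gt |x| 1 with h | h
  · have := (abs_le.1 (Real.abs_exp_sub_one_sub_id_le h)).2
    linarith
  · rcases lt_abs.1 h with h | h
    · have : Real.exp x ≤ Real.exp (x ^ 2) := Real.exp_le_exp.2 (by nlinarith)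
      linarith
    · have : Real.exp x ≤ 1 := Real.exp_le_one_iff.2 (by linarith)
      nlinarith

/-- Moment generating function of a centred two-point distribution. -/
lemma two_point_mgf_le {p : ℝ} (h0 : 0 ≤ p) (h1 : p ≤ 1) (a : ℝ) :
    p * Real.exp (a * (1 - p)) + (1 - p) * Real.exp (a * -p) ≤ Real.exp (a ^ 2) := by
  have h2 : Real.exp (a * (1 - p)) ≤ a * (1 - p) + Real.exp (a ^ 2) := by
    refine (exp_le_add_exp_sq _).trans ?_
    rw [add_le_add_iff_left, Real.exp_le_exp, mul_pow]
    exact mul_le_of_le_one_right (sq_nonneg _) (by nlinarith)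
  have h3 : Real.exp (a * -p) ≤ a * -p + Real.exp (a ^ 2) := by
    refine (exp_le_add_exp_sq _).trans ?_
    rw [add_le_add_iff_left, Real.exp_le_exp, mul_pow]
    exact mul_le_of_le_one_right (sq_nonneg _) (by nlinarith)
  calc _ ≤ p * (a * (1 - p) + Real.exp (a ^ 2)) + (1 - p) * (a * -p + Real.exp (a ^ 2)) := by
        gcongr
    _ = _ := by ring

/-- Greedy rounding of the coordinates in `S` to multiples of `s`, by the method of conditional
expectations. -/
lemma exists_rounding_potential {ι J : Type*} [Fintype J] {s : ℝ} (hs : 0 < s) (x : ι → ℝ)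
    (v : J → ι → ℝ) (S : Finset ι) :
    ∀ w : J → ℝ, (∀ j, 0 ≤ w j) → ∃ u : ι → ℤ, (∀ l ∈ S, |s * u l - x l| ≤ s) ∧
      ∑ j, w j * Real.exp (∑ l ∈ S, (s * u l - x l) * v j l) ≤
        ∑ j, w j * Real.exp (s ^ 2 * ∑ l ∈ S, v j l ^ 2) := by
  classical
  induction S using Finset.induction_on with
  | empty => exact fun w _ => ⟨0, by simp, by simp⟩
  | insert a S ha ih =>
    intro w hw
    set p := Int.fract (x a / s) with hp
    have hp0 : 0 ≤ p := Int.fract_nonneg _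
    have hp1 : p < 1 := Int.fract_lt_one _
    have hfl : s * (⌊x a / s⌋ : ℝ) - x a = s * -p := by
      rw [hp, Int.fract]
      field_simp
      ring
    let E : ℝ → ℝ := fun z => ∑ j, w j * Real.exp (z * v j a) *
      Real.exp (s ^ 2 * ∑ l ∈ S, v j l ^ 2)
    let F : ℝ := ∑ j, w j * Real.exp (s ^ 2 * ∑ l ∈ insert a S, v j l ^ 2)
    -- Rounding up with probability `p` is unbiased, and the expected potential is at most `F`;
    -- hence one of the two roundings does not exceed `F`.
    have havg : p * E (s * (1 - p)) + (1 - p) * E (s * -p) ≤ F := by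
      simp only [E, F]
      rw [Finset.mul_sum, Finset.mul_sum, ← Finset.sum_add_distrib]
      refine Finset.sum_le_sum fun j _ => ?_
      have h := two_point_mgf_le hp0 hp1.le (s * v j a)
      rw [Finset.sum_insert ha, mul_add, Real.exp_add]
      calc _ = w j * Real.exp (s ^ 2 * ∑ l ∈ S, v j l ^ 2) *
            (p * Real.exp (s * v j a * (1 - p)) + (1 - p) * Real.exp (s * v j a * -p)) := by
              rw [show s * (1 - p) * v j a = s * v j a * (1 - p) by ring,
                show s * -p * v j a = s * v j a * -p by ring]
              ring
        _ ≤ w j * Real.exp (s ^ 2 * ∑ l ∈ S, v j l ^ 2) * Real.exp ((s * v j a) ^ 2) := by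
              gcongr
              exact mul_nonneg (hw j) (Real.exp_nonneg _)
        _ = _ := by rw [mul_pow]; ring
    obtain ⟨c, hc1, hc2⟩ : ∃ c : ℤ, |s * c - x a| ≤ s ∧ E (s * c - x a) ≤ F := by
      by_cases h : E (s * -p) ≤ F
      · refine ⟨⌊x a / s⌋, ?_, by rwa [hfl]⟩
        rw [hfl, abs_le]
        constructor <;> nlinarith
      · have hup : s * ((⌊x a / s⌋ + 1 : ℤ) : ℝ) - x a = s * (1 - p) := by
          push_cast
          linarith
        refine ⟨⌊x a / s⌋ + 1, ?_, ?_⟩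
        · rw [hup, abs_le]
          constructor <;> nlinarith
        · rw [hup]
          push Not at h
          by_contra h'
          push Not at h'
          nlinarith
    -- The chosen error in coordinate `a` is absorbed into the weights.
    obtain ⟨u, hu1, hu2⟩ := ih (fun j => w j * Real.exp ((s * c - x a) * v j a))
      fun j => mul_nonneg (hw j) (Real.exp_nonneg _)
    have hne : ∀ l ∈ S, Function.update u a c l = u l := fun l hl =>
      Function.update_of_ne (by rintro rfl; exact ha hl) _ _
    refine ⟨Function.update u a c, ?_, ?_⟩
    · intro l hl
      rcases Finset.mem_insert.1 hl with rfl | hl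
      · simpa using hc1
      · rw [hne l hl]; exact hu1 l hl
    · refine le_trans (le_of_eq ?_) (hu2.trans hc2)
      refine Finset.sum_congr rfl fun j _ => ?_
      rw [Finset.sum_insert ha, Function.update_self, Real.exp_add, mul_assoc]
      congr 3
      exact Finset.sum_congr rfl fun l hl => by rw [hne l hl]

lemma le_of_sum_exp_le {J : Type*} [Fintype J] {f : J → ℝ} {B : ℝ} (hB : 0 < B)
    (h : ∑ j, Real.exp (f j) ≤ B) (j : J) : f j ≤ Real.log B := by
  rw [Real.le_log_iff_exp_le hB]
  exact (Finset.single_le_sum (f := fun j => Real.exp (f j)) (fun _ _ => Real.exp_nonneg _)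
    (Finset.mem_univ j)).trans h

/-- Rounding to the lattice with a small error in finitely many directions. -/
lemma exists_rounding {n K : ℕ} (hn : 1 ≤ n) {s lam V : ℝ} (hs : 0 < s) (hlam : 0 < lam)
    (x : Fin K → ℝ) (v : Fin n → Fin K → ℝ) (hv : ∀ j, ∑ l, v j l ^ 2 ≤ V) :
    ∃ u : Fin K → ℤ, (∀ l, |s * u l - x l| ≤ s) ∧
      ∀ j, |∑ l, (s * u l - x l) * v j l| ≤ Real.log (2 * n) / lam + lam * s ^ 2 * V := by
  let sg : Bool → ℝ := fun c => if c then 1 else -1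
  have hsg : ∀ c, sg c ^ 2 = 1 := by intro c; cases c <;> simp [sg]
  obtain ⟨u, hu1, hu2⟩ := exists_rounding_potential hs x
    (fun (p : Fin n × Bool) l => sg p.2 * lam * v p.1 l) Finset.univ (fun _ => 1)
    (fun _ => zero_le_one)
  have hn0 : (0 : ℝ) < n := by exact_mod_cast hn
  refine ⟨u, fun l => hu1 l (Finset.mem_univ l), fun j => ?_⟩
  have hbound : ∑ p : Fin n × Bool,
      Real.exp (∑ l, (s * u l - x l) * (sg p.2 * lam * v p.1 l)) ≤
      2 * n * Real.exp (lam ^ 2 * s ^ 2 * V) := by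
    simp only [one_mul] at hu2
    refine hu2.trans ?_
    calc _ ≤ ∑ _p : Fin n × Bool, Real.exp (lam ^ 2 * s ^ 2 * V) := by
          refine Finset.sum_le_sum fun p _ => Real.exp_le_exp.2 ?_
          simp only [mul_pow, hsg, one_mul, ← Finset.mul_sum]
          rw [← mul_assoc, mul_comm (s ^ 2)]
          gcongr
          exact hv p.1
      _ = _ := by simp; ring
  have hfin : ∀ c, sg c * (lam * ∑ l, (s * u l - x l) * v j l) ≤
      Real.log (2 * n) + lam ^ 2 * s ^ 2 * V := by
    intro c
    have := le_of_sum_exp_le (by positivity) hbound (j, c)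
    rw [Real.log_mul (by positivity) (Real.exp_ne_zero _), Real.log_exp] at this
    refine le_trans (le_of_eq ?_) this
    rw [Finset.mul_sum, Finset.mul_sum]
    exact Finset.sum_congr rfl fun l _ => by ring
  have h1 := hfin true
  have h2 := hfin false
  simp only [sg, if_true, Bool.false_eq_true, if_false] at h1 h2
  have h3 : lam * |∑ l, (s * u l - x l) * v j l| ≤ Real.log (2 * n) + lam ^ 2 * s ^ 2 * V := by
    rw [← abs_of_pos hlam, ← abs_mul, abs_of_pos hlam, abs_le]
    constructor <;> linarith
  have h4 : Real.log (2 * n) / lam + lam * s ^ 2 * V =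
      (Real.log (2 * n) + lam ^ 2 * s ^ 2 * V) / lam := by field_simp
  rw [h4, le_div_iff₀ hlam]
  linarith

/-- Rounding the points of a configuration one after another preserves all inner products of
distinct points. -/
lemma exists_lattice_configuration {n K : ℕ} (hn : 1 ≤ n) {s lam R : ℝ} (hs : 0 < s)
    (hlam : 0 < lam) (p : Fin n → Fin K → ℝ) (hp : ∀ i, ∑ l, p i l ^ 2 ≤ R) :
    ∃ u : Fin n → Fin K → ℤ, (∀ i l, |s * u i l - p i l| ≤ s) ∧
      ∀ i j, i ≠ j → |s ^ 2 * ∑ l, (u i l : ℝ) * u j l - ∑ l, p i l * p j l| ≤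
        2 * (Real.log (2 * n) / lam + lam * s ^ 2 * (2 * R + 2 * (s ^ 2 * K))) := by
  classical
  set D := Real.log (2 * n) / lam + lam * s ^ 2 * (2 * R + 2 * (s ^ 2 * K)) with hD
  -- Each pair is disturbed by at most `D` when either of its points is rounded, hence at most
  -- twice. A point is rounded against the current positions of the others, which are fixed at that
  -- moment; its product with itself is not controlled.
  have key : ∀ S : Finset (Fin n), ∃ y : Fin n → Fin K → ℝ,
      (∀ i ∈ S, ∃ u : Fin K → ℤ, ∀ l, y i l = s * u l) ∧ (∀ i l, |y i l - p i l| ≤ s) ∧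
      (∀ i ∉ S, y i = p i) ∧ ∀ i j, i ≠ j → |∑ l, y i l * y j l - ∑ l, p i l * p j l| ≤
        D * ((if i ∈ S then 1 else 0) + (if j ∈ S then 1 else 0)) := by
    intro S
    induction S using Finset.induction_on with
    | empty => exact ⟨p, by simp, by simp [hs.le], by simp, by simp⟩
    | insert a S ha ih =>
      obtain ⟨y, hy1, hy2, hy3, hy4⟩ := ih
      have hV : ∀ j, ∑ l, y j l ^ 2 ≤ 2 * R + 2 * (s ^ 2 * K) := by
        intro j
        calc ∑ l, y j l ^ 2 ≤ ∑ l, (2 * p j l ^ 2 + 2 * s ^ 2) := by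
              refine Finset.sum_le_sum fun l _ => ?_
              have h1 : (y j l - p j l) ^ 2 ≤ s ^ 2 := sq_le_sq' (abs_le.1 (hy2 j l)).1
                (abs_le.1 (hy2 j l)).2
              nlinarith [sq_nonneg (y j l - 2 * p j l)]
          _ = 2 * ∑ l, p j l ^ 2 + 2 * (s ^ 2 * K) := by
              rw [Finset.sum_add_distrib, ← Finset.mul_sum]
              simp
              ring
          _ ≤ _ := by gcongr; exact hp j
      obtain ⟨u, hu1, hu2⟩ := exists_rounding hn hs hlam (p a) y hV
      have hpair : ∀ j, j ≠ a →
          |∑ l, (s * u l) * y j l - ∑ l, p a l * p j l| ≤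
            D * (1 + (if j ∈ S then 1 else 0)) := by
        intro j hj
        have h1 := hu2 j
        have h2 := hy4 a j hj.symm
        rw [hy3 a ha, if_neg ha, zero_add] at h2
        have h3 : ∑ l, (s * u l) * y j l - ∑ l, p a l * p j l =
            ∑ l, (s * u l - p a l) * y j l + (∑ l, p a l * y j l - ∑ l, p a l * p j l) := by
          rw [← add_sub_assoc, ← Finset.sum_add_distrib]
          congr 1
          exact Finset.sum_congr rfl fun l _ => by ring
        rw [h3, mul_add, mul_one]
        exact (abs_add_le _ _).trans (add_le_add h1 h2)
      refine ⟨Function.update y a fun l => s * u l, ?_, ?_, ?_, ?_⟩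
      · intro i hi
        by_cases hia : i = a
        · subst hia
          exact ⟨u, by simp⟩
        · rw [Function.update_of_ne hia]
          exact hy1 i ((Finset.mem_insert.1 hi).resolve_left hia)
      · intro i l
        by_cases hia : i = a
        · subst hia
          simpa using hu1 l
        · rw [Function.update_of_ne hia]
          exact hy2 i l
      · intro i hi
        rw [Finset.mem_insert, not_or] at hi
        rw [Function.update_of_ne hi.1]
        exact hy3 i hi.2
      · intro i j hij
        by_cases hia : i = a
        · subst hia
          rw [Function.update_self, Function.update_of_ne hij.symm]
          simpa [hij.symm] using hpair j hij.symm
        · by_cases hja : j = a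
          · subst hja
            rw [Function.update_self, Function.update_of_ne hij]
            have := hpair i hij
            simp only [Finset.mem_insert, hij, false_or, true_or, if_true]
            rw [add_comm]
            simpa [mul_comm] using this
          · rw [Function.update_of_ne hia, Function.update_of_ne hja]
            simpa [hia, hja] using hy4 i j hij
  obtain ⟨y, hy1, hy2, -, hy4⟩ := key Finset.univ
  choose u hu using fun i => hy1 i (Finset.mem_univ i)
  refine ⟨u, fun i l => by rw [← hu]; exact hy2 i l, fun i j hij => ?_⟩
  have := hy4 i j hij
  simp only [Finset.mem_univ, if_true, hu] at this
  have h3 : ∑ l, s * (u i l : ℝ) * (s * u j l) = s ^ 2 * ∑ l, (u i l : ℝ) * u j l := by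
    rw [Finset.mul_sum]
    exact Finset.sum_congr rfl fun l _ => by ring
  rw [h3] at this
  linarith

/-! ### Upper bound: Johnson–Lindenstrauss with random signs. -/

/-- Averaging over all choices of `K` independent samples. -/
lemma exists_samples {Ω J : Type*} [Fintype Ω] [Nonempty Ω] [Fintype J] (K : ℕ) {β : ℝ}
    (W : J → Ω → ℝ)
    (hW : ∀ j, ∑ ω, Real.exp (W j ω) ≤ Fintype.card Ω * Real.exp β) :
    ∃ S : Fin K → Ω, ∑ j, Real.exp (∑ r, W j (S r)) ≤ Fintype.card J * Real.exp (K * β) := by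
  classical
  by_contra! h
  have hlt := Finset.sum_lt_sum_of_nonempty (s := (Finset.univ : Finset (Fin K → Ω)))
    Finset.univ_nonempty fun S _ => h S
  refine absurd hlt (not_lt.2 ?_)
  rw [Finset.sum_comm]
  calc ∑ j, ∑ S : Fin K → Ω, Real.exp (∑ r, W j (S r))
      = ∑ j, (∑ ω, Real.exp (W j ω)) ^ K := by
        refine Finset.sum_congr rfl fun j _ => ?_
        simp only [Real.exp_sum]
        rw [← Fintype.piFinset_univ, ← Finset.prod_univ_sum (fun _ : Fin K => Finset.univ)
          fun _ ω => Real.exp (W j ω)]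
        simp
    _ ≤ ∑ _j : J, (Fintype.card Ω * Real.exp β) ^ K := by
        refine Finset.sum_le_sum fun j _ => ?_
        exact pow_le_pow_left₀ (Finset.sum_nonneg fun _ _ => Real.exp_nonneg _) (hW j) K
    _ = _ := by
        simp [mul_pow, Real.exp_nat_mul]
        ring

/-- The sum `∑ ± x l` with the signs given by `τ`. -/
def signSum {k : ℕ} (x : Fin k → ℝ) (τ : Fin k → Bool) : ℝ :=
  ∑ l, (if τ l then 1 else -1) * x l

lemma sum_signs_succ {k : ℕ} (x : Fin (k + 1) → ℝ) (y : Fin (k + 1) → ℝ) (F : ℝ → ℝ → ℝ) :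
    ∑ τ : Fin (k + 1) → Bool, F (signSum x τ) (signSum y τ) =
      ∑ τ : Fin k → Bool,
        (F (x 0 + signSum (Fin.tail x) τ) (y 0 + signSum (Fin.tail y) τ) +
          F (-x 0 + signSum (Fin.tail x) τ) (-y 0 + signSum (Fin.tail y) τ)) := by
  rw [← (Fin.consEquiv fun _ => Bool).sum_comp, Fintype.sum_prod_type, Fintype.sum_bool,
    ← Finset.sum_add_distrib]
  simp [signSum, Fin.sum_univ_succ, Fin.tail]

lemma sum_signSum_mul {k : ℕ} (x y : Fin k → ℝ) : ∀ a b : ℝ,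
    ∑ τ, (a + signSum x τ) * (b + signSum y τ) = 2 ^ k * (a * b + ∑ l, x l * y l) := by
  induction k with
  | zero => intro a b; simp [signSum]
  | succ k ih =>
    intro a b
    rw [sum_signs_succ x y fun X Y => (a + X) * (b + Y)]
    have h : ∀ τ : Fin k → Bool,
        (a + (x 0 + signSum (Fin.tail x) τ)) * (b + (y 0 + signSum (Fin.tail y) τ)) +
        (a + (-x 0 + signSum (Fin.tail x) τ)) * (b + (-y 0 + signSum (Fin.tail y) τ)) =
        2 * ((a + signSum (Fin.tail x) τ) * (b + signSum (Fin.tail y) τ)) +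
          2 * (x 0 * y 0) := fun τ => by ring
    simp only [h]
    rw [Finset.sum_add_distrib, ← Finset.mul_sum, ih, Fin.sum_univ_succ]
    simp only [Finset.sum_const, Finset.card_univ, Fintype.card_fun, Fintype.card_bool,
      Fintype.card_fin, nsmul_eq_mul, Fin.tail]
    push_cast
    ring

/-- Averaging over one sign produces `cosh (2cAz) ≤ exp ((2cAz)²/2)`, which merely enlarges the
coefficient of `A²`. -/
lemma exp_sq_add_exp_sq_le (c A z : ℝ) :
    Real.exp (c * (A + z) ^ 2) + Real.exp (c * (A - z) ^ 2) ≤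
      2 * (Real.exp (c * z ^ 2) * Real.exp (c * (1 + 2 * c * z ^ 2) * A ^ 2)) := by
  have h := Real.cosh_le_exp_half_sq (2 * c * A * z)
  rw [Real.cosh_eq] at h
  have h1 : Real.exp (c * (A + z) ^ 2) =
      Real.exp (c * z ^ 2) * Real.exp (c * A ^ 2) * Real.exp (2 * c * A * z) := by
    rw [← Real.exp_add, ← Real.exp_add]; ring_nf
  have h2 : Real.exp (c * (A - z) ^ 2) =
      Real.exp (c * z ^ 2) * Real.exp (c * A ^ 2) * Real.exp (-(2 * c * A * z)) := by
    rw [← Real.exp_add, ← Real.exp_add]; ring_nf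
  have h3 : Real.exp (c * (1 + 2 * c * z ^ 2) * A ^ 2) =
      Real.exp (c * A ^ 2) * Real.exp ((2 * c * A * z) ^ 2 / 2) := by
    rw [← Real.exp_add]; ring_nf
  rw [h1, h2, h3, ← mul_add]
  have h4 : 0 < Real.exp (c * z ^ 2) * Real.exp (c * A ^ 2) := by positivity
  nlinarith

/-- Peel off one sign at a time: `c` grows by a factor at most `exp (x 0 ^ 2)`, so the condition on
`c * exp ‖x‖²` is inherited by the tail. -/
lemma sum_exp_signSum_sq_le {k : ℕ} (x : Fin k → ℝ) : ∀ a c : ℝ, 0 ≤ c →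
    c * Real.exp (∑ l, x l ^ 2) ≤ 1 / 2 →
    ∑ τ, Real.exp (c * (a + signSum x τ) ^ 2) ≤
      2 ^ k * Real.exp ((∑ l, x l ^ 2) / 2 + c * Real.exp (∑ l, x l ^ 2) * a ^ 2) := by
  induction k with
  | zero => intro a c _ _; simp [signSum]
  | succ k ih =>
    intro a c hc hcx
    rw [sum_signs_succ x x fun X _ => Real.exp (c * (a + X) ^ 2)]
    set Q := ∑ l, Fin.tail x l ^ 2 with hQ
    have hQ0 : 0 ≤ Q := Finset.sum_nonneg fun _ _ => sq_nonneg _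
    have hsum : ∑ l, x l ^ 2 = x 0 ^ 2 + Q := by rw [Fin.sum_univ_succ]; rfl
    rw [hsum] at hcx ⊢
    have hc2 : c ≤ 1 / 2 := by
      refine le_trans (le_mul_of_one_le_right hc ?_) hcx
      exact Real.one_le_exp (by positivity)
    set c' := c * (1 + 2 * c * x 0 ^ 2) with hc'
    have hcc : c' ≤ c * Real.exp (x 0 ^ 2) := by
      rw [hc']
      gcongr
      have := Real.add_one_le_exp (x 0 ^ 2)
      nlinarith [sq_nonneg (x 0)]
    have hcQ : c' * Real.exp Q ≤ c * Real.exp (x 0 ^ 2 + Q) := by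
      rw [Real.exp_add, ← mul_assoc]
      gcongr
    have hIH := ih (Fin.tail x) a c' (by positivity) (hcQ.trans hcx)
    rw [← hQ] at hIH
    calc _ ≤ ∑ τ : Fin k → Bool, 2 * (Real.exp (c * x 0 ^ 2) *
          Real.exp (c' * (a + signSum (Fin.tail x) τ) ^ 2)) := by
          refine Finset.sum_le_sum fun τ _ => ?_
          have := exp_sq_add_exp_sq_le c (a + signSum (Fin.tail x) τ) (x 0)
          rwa [show a + signSum (Fin.tail x) τ + x 0 = a + (x 0 + signSum (Fin.tail x) τ) by ring,
            show a + signSum (Fin.tail x) τ - x 0 = a + (-x 0 + signSum (Fin.tail x) τ) by ring]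
            at this
      _ = 2 * Real.exp (c * x 0 ^ 2) *
          ∑ τ : Fin k → Bool, Real.exp (c' * (a + signSum (Fin.tail x) τ) ^ 2) := by
          rw [Finset.mul_sum]
          exact Finset.sum_congr rfl fun _ _ => by ring
      _ ≤ 2 * Real.exp (c * x 0 ^ 2) *
          (2 ^ k * Real.exp (Q / 2 + c' * Real.exp Q * a ^ 2)) := by gcongr
      _ = 2 ^ (k + 1) * Real.exp (c * x 0 ^ 2 + (Q / 2 + c' * Real.exp Q * a ^ 2)) := by
          rw [Real.exp_add (c * x 0 ^ 2)]; ring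
      _ ≤ _ := by
          refine mul_le_mul_of_nonneg_left (Real.exp_le_exp.2 ?_) (by positivity)
          have h1 : c * x 0 ^ 2 ≤ 1 / 2 * x 0 ^ 2 := by gcongr
          have h2 := mul_le_mul_of_nonneg_right hcQ (sq_nonneg a)
          linarith

lemma sum_exp_signSum_sq_div_six_le {k : ℕ} (x : Fin k → ℝ) (hx : ∑ l, x l ^ 2 ≤ 1) :
    ∑ τ, Real.exp (signSum x τ ^ 2 / 6) ≤ 2 ^ k * Real.exp (1 / 2) := by
  have he : Real.exp (∑ l, x l ^ 2) ≤ 3 :=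
    (Real.exp_le_exp.2 hx).trans (by linarith [Real.exp_one_lt_d9])
  -- `1/6` is admissible because `e ≤ 3`.
  have h := sum_exp_signSum_sq_le x 0 (1 / 6) (by norm_num) (by linarith)
  simp only [zero_add] at h
  calc ∑ τ, Real.exp (signSum x τ ^ 2 / 6) = ∑ τ, Real.exp (1 / 6 * signSum x τ ^ 2) :=
        Finset.sum_congr rfl fun _ _ => by ring_nf
    _ ≤ _ := h
    _ ≤ 2 ^ k * Real.exp (1 / 2) := by
        gcongr
        norm_num
        linarith

lemma exp_le_one_add_add_sq_mul_exp (z : ℝ) :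
    Real.exp z ≤ 1 + z + z ^ 2 * Real.exp |z| := by
  have h := Complex.norm_exp_sub_sum_le_norm_mul_exp (z : ℂ) 2
  simp only [Finset.sum_range_succ, Finset.sum_range_zero, zero_add, pow_zero, pow_one,
    Nat.factorial, Nat.cast_one, div_one, mul_one, Complex.norm_real, Real.norm_eq_abs,
    sq_abs] at h
  have h2 : Complex.exp z - (1 + z) = ((Real.exp z - (1 + z) : ℝ) : ℂ) := by push_cast; ring
  rw [h2, Complex.norm_real, Real.norm_eq_abs] at h
  linarith [(abs_le.1 h).2]

/-- Moment generating function of a centred product of two sign sums. -/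
lemma sum_exp_signSum_mul_le {k : ℕ} (x y : Fin k → ℝ) (hx : ∑ l, x l ^ 2 ≤ 1)
    (hy : ∑ l, y l ^ 2 ≤ 1) {lam : ℝ} (hlam : |lam| ≤ 1 / 12) :
    ∑ τ, Real.exp (lam * (signSum x τ * signSum y τ - ∑ l, x l * y l)) ≤
      2 ^ k * Real.exp (576 * lam ^ 2) := by
  set m := ∑ l, x l * y l with hm
  have hmean : ∑ τ, (signSum x τ * signSum y τ - m) = 0 := by
    have := sum_signSum_mul x y 0 0
    simp only [zero_add, mul_zero] at this
    rw [Finset.sum_sub_distrib, this]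
    simp [hm]
  have hm1 : |m| ≤ 1 := by
    have h1 : |m| ≤ ∑ l, (x l ^ 2 + y l ^ 2) / 2 := by
      refine (Finset.abs_sum_le_sum_abs _ _).trans (Finset.sum_le_sum fun l _ => ?_)
      rw [abs_le]
      constructor <;> nlinarith [sq_nonneg (x l + y l), sq_nonneg (x l - y l)]
    rw [← Finset.sum_div, Finset.sum_add_distrib] at h1
    linarith
  have hpt : ∀ τ, Real.exp (lam * (signSum x τ * signSum y τ - m)) ≤
      1 + lam * (signSum x τ * signSum y τ - m) + 144 * lam ^ 2 * Real.exp (1 / 6) *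
        (Real.exp (signSum x τ ^ 2 / 6) + Real.exp (signSum y τ ^ 2 / 6)) := by
    intro τ
    set X := signSum x τ
    set Y := signSum y τ
    set W := X * Y - m
    -- As `|lam| ≤ 1/12`, the exponent is at most `t`. A second `exp t` pays for the factor `t²`,
    -- and `2t` is controlled by the mean of `X²/6` and `Y²/6`, whose exponentials have bounded
    -- expectation.
    set t := |W| / 12 with ht
    have ht0 : 0 ≤ t := by positivity
    have hW : W ^ 2 = 144 * t ^ 2 := by rw [ht, div_pow, sq_abs]; ring
    have hexp := exp_le_one_add_add_sq_mul_exp (lam * W)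
    have h1 : |lam * W| ≤ t := by
      rw [abs_mul, ht]
      have := mul_le_mul_of_nonneg_right hlam (abs_nonneg W)
      linarith
    have h2 : t ^ 2 ≤ 2 * Real.exp t := by linarith [Real.quadratic_le_exp_of_nonneg ht0]
    have h3 : 2 * t ≤ 1 / 6 + (X ^ 2 / 6 + Y ^ 2 / 6) / 2 := by
      have hW' : |W| ≤ (X ^ 2 + Y ^ 2) / 2 + 1 := by
        rw [abs_le] at hm1 ⊢
        constructor <;>
          nlinarith [sq_nonneg (X + Y), sq_nonneg (X - Y), hm1.1, hm1.2]
      rw [ht]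
      linarith
    have h4 : Real.exp ((X ^ 2 / 6 + Y ^ 2 / 6) / 2) ≤
        (Real.exp (X ^ 2 / 6) + Real.exp (Y ^ 2 / 6)) / 2 := by
      have e1 : Real.exp (X ^ 2 / 6) = Real.exp (X ^ 2 / 6 / 2) ^ 2 := by
        rw [← Real.exp_nat_mul]; ring_nf
      have e2 : Real.exp (Y ^ 2 / 6) = Real.exp (Y ^ 2 / 6 / 2) ^ 2 := by
        rw [← Real.exp_nat_mul]; ring_nf
      rw [add_div, Real.exp_add, e1, e2]
      nlinarith [sq_nonneg (Real.exp (X ^ 2 / 6 / 2) - Real.exp (Y ^ 2 / 6 / 2))]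
    have h5 : (lam * W) ^ 2 * Real.exp |lam * W| ≤ 144 * lam ^ 2 * Real.exp (1 / 6) *
        (Real.exp (X ^ 2 / 6) + Real.exp (Y ^ 2 / 6)) := by
      calc (lam * W) ^ 2 * Real.exp |lam * W|
          ≤ (lam * W) ^ 2 * Real.exp t := by gcongr
        _ = 144 * lam ^ 2 * (t ^ 2 * Real.exp t) := by rw [mul_pow, hW]; ring
        _ ≤ 144 * lam ^ 2 * (2 * Real.exp t * Real.exp t) := by gcongr
        _ = 288 * lam ^ 2 * Real.exp (2 * t) := by rw [two_mul t, Real.exp_add]; ring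
        _ ≤ 288 * lam ^ 2 * Real.exp (1 / 6 + (X ^ 2 / 6 + Y ^ 2 / 6) / 2) := by gcongr
        _ = 288 * lam ^ 2 * Real.exp (1 / 6) * Real.exp ((X ^ 2 / 6 + Y ^ 2 / 6) / 2) := by
            rw [Real.exp_add]; ring
        _ ≤ 288 * lam ^ 2 * Real.exp (1 / 6) *
            ((Real.exp (X ^ 2 / 6) + Real.exp (Y ^ 2 / 6)) / 2) := by gcongr
        _ = _ := by ring
    linarith
  have h23 : Real.exp (1 / 6) * Real.exp (1 / 2) ≤ 2 := by
    rw [← Real.exp_add, ← Real.le_log_iff_exp_le two_pos]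
    linarith [Real.log_two_gt_d9]
  have hX := sum_exp_signSum_sq_div_six_le x hx
  have hY := sum_exp_signSum_sq_div_six_le y hy
  calc _ ≤ ∑ τ, (1 + lam * (signSum x τ * signSum y τ - m) + 144 * lam ^ 2 * Real.exp (1 / 6) *
        (Real.exp (signSum x τ ^ 2 / 6) + Real.exp (signSum y τ ^ 2 / 6))) :=
        Finset.sum_le_sum fun τ _ => hpt τ
    _ = 2 ^ k + 144 * lam ^ 2 * Real.exp (1 / 6) *
        (∑ τ, Real.exp (signSum x τ ^ 2 / 6) + ∑ τ, Real.exp (signSum y τ ^ 2 / 6)) := by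
        rw [Finset.sum_add_distrib, Finset.sum_add_distrib, ← Finset.mul_sum, hmean,
          ← Finset.mul_sum, Finset.sum_add_distrib]
        simp
    _ ≤ 2 ^ k + 144 * lam ^ 2 * Real.exp (1 / 6) *
        (2 ^ k * Real.exp (1 / 2) + 2 ^ k * Real.exp (1 / 2)) := by gcongr
    _ = 2 ^ k * (1 + 288 * lam ^ 2 * (Real.exp (1 / 6) * Real.exp (1 / 2))) := by ring
    _ ≤ 2 ^ k * (1 + 288 * lam ^ 2 * 2) := by gcongr
    _ ≤ 2 ^ k * Real.exp (576 * lam ^ 2) := by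
        gcongr
        linarith [Real.add_one_le_exp (576 * lam ^ 2)]

/-- Johnson–Lindenstrauss dimension reduction for inner products. -/
lemma exists_dimension_reduction {n k K : ℕ} (hn : 1 ≤ n) (hK : 1 ≤ K) {lam : ℝ}
    (hlam : 0 < lam) (hlam' : lam ≤ 1 / 12) (x : Fin n → Fin k → ℝ)
    (hx : ∀ i, ∑ l, x i l ^ 2 ≤ 1) :
    ∃ p : Fin n → Fin K → ℝ, ∀ i j, |∑ r, p i r * p j r - ∑ l, x i l * x j l| ≤
      Real.log (2 * n ^ 2) / (lam * K) + 576 * lam := by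
  let sg : Bool → ℝ := fun c => if c then 1 else -1
  have hsg : ∀ c, sg c ^ 2 = 1 ∧ |sg c| = 1 := by intro c; cases c <;> simp [sg]
  have hn0 : (0 : ℝ) < n := by exact_mod_cast hn
  have hK0 : (0 : ℝ) < K := by exact_mod_cast hK
  obtain ⟨S, hS⟩ := exists_samples (Ω := Fin k → Bool) (J := Fin n × Fin n × Bool) K
    (β := 576 * lam ^ 2)
    (fun q τ => sg q.2.2 * lam *
      (signSum (x q.1) τ * signSum (x q.2.1) τ - ∑ l, x q.1 l * x q.2.1 l)) (by
    intro q
    have := sum_exp_signSum_mul_le (x q.1) (x q.2.1) (hx _) (hx _) (lam := sg q.2.2 * lam)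
      (by rw [abs_mul, (hsg _).2, one_mul, abs_of_pos hlam]; exact hlam')
    rw [mul_pow, (hsg _).1, one_mul] at this
    simpa using this)
  have hcard : ((Fintype.card (Fin n × Fin n × Bool) : ℕ) : ℝ) = 2 * n ^ 2 := by
    simp; ring
  rw [hcard] at hS
  refine ⟨fun i r => signSum (x i) (S r) / √K, fun i j => ?_⟩
  set m := ∑ l, x i l * x j l with hm
  set T := ∑ r, (signSum (x i) (S r) * signSum (x j) (S r) - m) with hT
  have hsum : ∑ r, signSum (x i) (S r) / √K * (signSum (x j) (S r) / √K) - m = T / K := by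
    rw [hT, Finset.sum_sub_distrib, sub_div, Finset.sum_div]
    congr 1
    · refine Finset.sum_congr rfl fun r _ => ?_
      rw [div_mul_div_comm, Real.mul_self_sqrt hK0.le]
    · simp
      field_simp
  have hfin : ∀ c, sg c * lam * T ≤ Real.log (2 * n ^ 2) + K * (576 * lam ^ 2) := by
    intro c
    have := le_of_sum_exp_le (by positivity) hS (i, j, c)
    rw [Real.log_mul (by positivity) (Real.exp_ne_zero _), Real.log_exp, ← Finset.mul_sum]
      at this
    exact this
  have h1 := hfin true
  have h2 := hfin false
  simp only [sg, if_true, Bool.false_eq_true, if_false] at h1 h2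
  have h3 : lam * |T| ≤ Real.log (2 * n ^ 2) + K * (576 * lam ^ 2) := by
    rw [← abs_of_pos hlam, ← abs_mul, abs_of_pos hlam, abs_le]
    constructor <;> linarith
  rw [hsum, abs_div, abs_of_pos hK0, div_le_iff₀ hK0]
  have h4 : (Real.log (2 * n ^ 2) / (lam * K) + 576 * lam) * K =
      (Real.log (2 * n ^ 2) + K * (576 * lam ^ 2)) / lam := by field_simp
  rw [h4, le_div_iff₀ hlam]
  linarith

/-! ### Upper bound: sketches in the three ranges of dimension. -/

/-- Cauchy–Schwarz gives `‖p‖₁ ≤ 2√K`, and rounding adds at most `s` per coordinate. -/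
lemma sum_abs_lattice_le {K : ℕ} (hK : 1 ≤ K) {s : ℝ} (hs : 0 < s) {p : Fin K → ℝ}
    (hp : ∑ l, p l ^ 2 ≤ 4) {u : Fin K → ℤ} (hu : ∀ l, |s * u l - p l| ≤ s) :
    ∑ l, |(u l : ℝ)| ≤ (1 + 2 / (s * √K)) * K := by
  have hK0 : (0 : ℝ) < K := by exact_mod_cast hK
  have hsq : 0 < √(K : ℝ) := Real.sqrt_pos.2 hK0
  have h1 : ∑ l, |p l| ≤ 2 * √K := by
    have h := sq_sum_le_card_mul_sum_sq (s := Finset.univ) (f := fun l : Fin K => |p l|)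
    simp only [sq_abs, Finset.card_univ, Fintype.card_fin] at h
    refine abs_le_of_sq_le_sq' ?_ (by positivity) |>.2
    rw [mul_pow, Real.sq_sqrt hK0.le]
    nlinarith
  have h2 : s * ∑ l, |(u l : ℝ)| ≤ ∑ l, |p l| + s * K := by
    calc s * ∑ l, |(u l : ℝ)| = ∑ l, |s * u l| := by
          rw [Finset.mul_sum]
          exact Finset.sum_congr rfl fun l _ => by rw [abs_mul, abs_of_pos hs]
      _ ≤ ∑ l, (|p l| + s) := Finset.sum_le_sum fun l _ => by
          have := abs_sub_abs_le_abs_sub (s * u l) (p l)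
          linarith [hu l]
      _ = _ := by rw [Finset.sum_add_distrib]; simp; ring
  have h3 : (1 + 2 / (s * √K)) * K = (s * K + 2 * √K) / s := by
    have := Real.sq_sqrt hK0.le
    field_simp
    linear_combination -2 * this
  rw [h3, le_div_iff₀ hs]
  linarith

lemma sum_sq_le_one_of_norm_le {k : ℕ} {x : EuclideanSpace ℝ (Fin k)} (hx : ‖x‖ ≤ 1) :
    ∑ l, x l ^ 2 ≤ 1 := by
  rw [← EuclideanSpace.real_norm_sq_eq]
  exact pow_le_one₀ (norm_nonneg _) hx

lemma inner_eq_sum {k : ℕ} (x y : EuclideanSpace ℝ (Fin k)) :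
    inner ℝ x y = ∑ l, x l * y l := by
  simp [PiLp.inner_apply, mul_comm]

/-- Coordinatewise rounding to a fine lattice. -/
lemma exists_sketch_of_fine_lattice {n k : ℕ} {ε : ℝ} (hk : 1 ≤ k) (hε : 0 < ε) (hε1 : ε ≤ 1) :
    ∃ b enc dec, IsDistanceSketch n k ε b enc dec ∧
      (b : ℝ) ≤ n * (k * Real.log (Real.exp 1 * (3 + 48 / ε)) + Real.log (1 + 4 / ε)) /
        Real.log 2 + 1 := by
  have hk0 : (0 : ℝ) < k := by exact_mod_cast hk
  have hsq : 0 < √(k : ℝ) := Real.sqrt_pos.2 hk0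
  -- The error in an inner product is at most `2s√k + s²k = ε/6 + ε²/144 ≤ ε/4`.
  set s := ε / 12 / √k with hs
  have hs0 : 0 < s := by positivity
  have hθ : s * √k = ε / 12 := by rw [hs]; field_simp
  have hα : 3 + 48 / ε = 1 + 2 * (1 + 2 / (s * √k)) := by rw [hθ]; field_simp; ring
  rw [hα]
  refine exists_sketch_of_lattice (σ := s ^ 2) hε (by positivity) fun x hx => ?_
  let u : Fin n → Fin k → ℤ := fun i l => ⌊x i l / s⌋
  have hu : ∀ i l, |s * u i l - x i l| ≤ s := fun i l => by
    have h1 := Int.floor_le (x i l / s)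
    have h2 := (Int.lt_floor_add_one (x i l / s)).le
    rw [le_div_iff₀ hs0] at h1
    rw [div_le_iff₀ hs0] at h2
    rw [abs_le]
    constructor <;> simp only [u] <;> linarith
  have hx4 : ∀ i, ∑ l, x i l ^ 2 ≤ 4 := fun i =>
    (sum_sq_le_one_of_norm_le (hx i)).trans (by norm_num)
  have hx1 : ∀ i, ∑ l, |x i l| ≤ √k := fun i => by
    have h := sq_sum_le_card_mul_sum_sq (s := Finset.univ) (f := fun l : Fin k => |x i l|)
    simp only [sq_abs, Finset.card_univ, Fintype.card_fin] at h
    refine Real.le_sqrt_of_sq_le (h.trans ?_)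
    exact mul_le_of_le_one_right hk0.le (sum_sq_le_one_of_norm_le (hx i))
  refine ⟨u, fun i => sum_abs_lattice_le hk hs0 (hx4 i) (hu i), fun i j _ => ?_⟩
  rw [inner_eq_sum]
  have hsplit : s ^ 2 * ∑ l, (u i l : ℝ) * u j l - ∑ l, x i l * x j l =
      ∑ l, ((s * u i l - x i l) * x j l + (s * u j l - x j l) * x i l +
        (s * u i l - x i l) * (s * u j l - x j l)) := by
    rw [Finset.mul_sum, ← Finset.sum_sub_distrib]
    exact Finset.sum_congr rfl fun l _ => by ring
  rw [hsplit]
  calc _ ≤ ∑ l, (s * |x j l| + s * |x i l| + s * s) := by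
        refine (Finset.abs_sum_le_sum_abs _ _).trans (Finset.sum_le_sum fun l _ => ?_)
        refine (abs_add_three _ _ _).trans ?_
        rw [abs_mul, abs_mul, abs_mul]
        gcongr <;> exact hu _ l
    _ = s * ∑ l, |x j l| + s * ∑ l, |x i l| + (s * √k) ^ 2 := by
        rw [mul_pow, Real.sq_sqrt hk0.le, Finset.sum_add_distrib, Finset.sum_add_distrib,
          ← Finset.mul_sum, ← Finset.mul_sum]
        simp
        ring
    _ ≤ s * √k + s * √k + (s * √k) ^ 2 := by
        gcongr <;> exact hx1 _
    _ ≤ ε / 4 := by rw [hθ]; nlinarith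

/-- Randomised rounding to a coarse lattice, after a map to `ℝ^K` that almost preserves inner
products. -/
lemma exists_sketch_of_coarse_lattice {n k K : ℕ} {ε : ℝ} (hn : (100 : ℝ) ≤ n) (hK : 1 ≤ K)
    (hε : 0 < ε) (hε1 : ε ≤ 1) (hKn : K ≤ 442369 * Real.log n / ε ^ 2)
    (h : ∀ x : Fin n → EuclideanSpace ℝ (Fin k), (∀ i, ‖x i‖ ≤ 1) →
      ∃ p : Fin n → Fin K → ℝ, ∀ i j, |∑ l, p i l * p j l - inner ℝ (x i) (x j)| ≤ ε / 8) :
    ∃ b enc dec, IsDistanceSketch n k ε b enc dec ∧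
      (b : ℝ) ≤ n * (K * Real.log (Real.exp 1 *
        (3 + 4 * √(442369 * Real.log n / (ε ^ 2 * K)))) + Real.log (1 + 4 / ε)) /
        Real.log 2 + 1 := by
  have hK0 : (0 : ℝ) < K := by exact_mod_cast hK
  have hsq : 0 < √(K : ℝ) := Real.sqrt_pos.2 hK0
  have hl := four_le_log hn
  set l := Real.log n with hl'
  have hl0 : 0 < l := by linarith
  set s := ε / √(442369 * l) with hs
  have hs0 : 0 < s := by positivity
  have hs2 : s ^ 2 = ε ^ 2 / (442369 * l) := by
    rw [hs, div_pow, Real.sq_sqrt (by positivity)]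
  have hsK : s ^ 2 * K ≤ 1 := by
    rw [hs2, div_mul_eq_mul_div, div_le_one (by positivity)]
    rw [le_div_iff₀ (by positivity)] at hKn
    linarith
  have hα : 3 + 4 * √(442369 * l / (ε ^ 2 * K)) = 1 + 2 * (1 + 2 / (s * √K)) := by
    have : √(442369 * l / (ε ^ 2 * K)) = 1 / (s * √K) := by
      rw [Real.sqrt_div (by positivity), Real.sqrt_mul (sq_nonneg ε), Real.sqrt_sq hε.le, hs]
      field_simp
    rw [this]
    ring
  rw [hα]
  refine exists_sketch_of_lattice (σ := s ^ 2) hε (by positivity) fun x hx => ?_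
  obtain ⟨p, hp⟩ := h x hx
  have hp2 : ∀ i, ∑ l, p i l ^ 2 ≤ 2 := fun i => by
    have h1 := (abs_le.1 (hp i i)).2
    rw [real_inner_self_eq_norm_sq] at h1
    have h2 : ‖x i‖ ^ 2 ≤ 1 := pow_le_one₀ (norm_nonneg _) (hx i)
    simp only [← pow_two] at h1
    linarith
  have hn1 : 1 ≤ n := by
    have : (1 : ℝ) ≤ n := by linarith
    exact_mod_cast this
  -- This `lam` makes the term `log (2n)/lam` at most `ε/32`; the choice of `s` makes the variance
  -- term smaller still.
  obtain ⟨u, hu1, hu2⟩ := exists_lattice_configuration hn1 hs0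
    (lam := 64 * l / ε) (by positivity) p hp2
  refine ⟨u, fun i => sum_abs_lattice_le hK hs0 ((hp2 i).trans (by norm_num)) (hu1 i),
    fun i j hij => ?_⟩
  have hlog : Real.log (2 * n) ≤ 2 * l := by
    rw [hl', ← Nat.cast_ofNat, ← Real.log_pow]
    exact Real.log_le_log (by positivity) (by push_cast; nlinarith)
  have hD : 2 * (Real.log (2 * n) / (64 * l / ε) +
      64 * l / ε * s ^ 2 * (2 * 2 + 2 * (s ^ 2 * K))) ≤ ε / 8 := by
    have h1 : Real.log (2 * n) / (64 * l / ε) ≤ ε / 32 := by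
      rw [div_le_iff₀ (by positivity)]
      have : ε / 32 * (64 * l / ε) = 2 * l := by field_simp; norm_num
      rw [this]
      exact hlog
    have h2 : 64 * l / ε * s ^ 2 = 64 / 442369 * ε := by rw [hs2]; field_simp
    rw [h2]
    nlinarith
  calc _ = |(s ^ 2 * ∑ l, (u i l : ℝ) * u j l - ∑ l, p i l * p j l) +
        (∑ l, p i l * p j l - inner ℝ (x i) (x j))| := by congr 1; ring
    _ ≤ ε / 8 + ε / 8 := (abs_add_le _ _).trans
        (add_le_add ((hu2 i j hij).trans hD) (hp i j))
    _ = ε / 4 := by ring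

/-- With `lam = ε/9216`, both `576 * lam` and the logarithmic term are at most `ε/16`; the latter
uses `442368 = 48 * 9216`. -/
lemma exists_dimension_reduction_log {n k K : ℕ} {ε : ℝ} (hn : (100 : ℝ) ≤ n) (hε : 0 < ε)
    (hε1 : ε ≤ 1) (hK : 442368 * Real.log n / ε ^ 2 ≤ K)
    (x : Fin n → EuclideanSpace ℝ (Fin k)) (hx : ∀ i, ‖x i‖ ≤ 1) :
    ∃ p : Fin n → Fin K → ℝ, ∀ i j, |∑ l, p i l * p j l - inner ℝ (x i) (x j)| ≤ ε / 8 := by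
  have hl := four_le_log hn
  set l := Real.log n with hl'
  have hl0 : 0 < l := by linarith
  have hK0 : (0 : ℝ) < K := lt_of_lt_of_le (by positivity) hK
  have hn1 : 1 ≤ n := by
    have : (1 : ℝ) ≤ n := by linarith
    exact_mod_cast this
  obtain ⟨p, hp⟩ := exists_dimension_reduction hn1 (K := K) (by exact_mod_cast hK0)
    (lam := ε / 9216) (by positivity) (by linarith) (fun i l => x i l)
    fun i => sum_sq_le_one_of_norm_le (hx i)
  refine ⟨p, fun i j => ?_⟩
  rw [inner_eq_sum]
  refine (hp i j).trans ?_
  have hlog : Real.log (2 * n ^ 2) ≤ 3 * l := by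
    rw [hl', ← Nat.cast_ofNat (n := 3), ← Real.log_pow]
    exact Real.log_le_log (by positivity) (by nlinarith [sq_nonneg (n : ℝ)])
  have h1 : Real.log (2 * n ^ 2) / (ε / 9216 * K) ≤ ε / 16 := by
    rw [div_le_iff₀ (by positivity)]
    rw [div_le_iff₀ (by positivity)] at hK
    nlinarith
  linarith

lemma log_one_add_four_div_le {n : ℕ} {ε : ℝ} (hn : (100 : ℝ) ≤ n) (hε : 0 < ε)
    (hnε : 1 / (n : ℝ) ^ (0.49 : ℝ) ≤ ε) : Real.log (1 + 4 / ε) ≤ 2 * Real.log n := by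
  have hn0 : (0 : ℝ) < n := by linarith
  have h1 : 1 / ε ≤ n := by
    have h2 : (n : ℝ) ^ (0.49 : ℝ) ≤ n := by
      calc (n : ℝ) ^ (0.49 : ℝ) ≤ (n : ℝ) ^ (1 : ℝ) :=
            Real.rpow_le_rpow_of_exponent_le (by linarith) (by norm_num)
        _ = n := Real.rpow_one _
    have hpos : (0 : ℝ) < (n : ℝ) ^ (0.49 : ℝ) := by positivity
    rw [div_le_iff₀ hpos] at hnε
    rw [div_le_iff₀ hε]
    nlinarith
  rw [show 2 * Real.log n = Real.log ((n : ℝ) ^ 2) by rw [Real.log_pow]; norm_num]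
  refine Real.log_le_log (by positivity) ?_
  have : 4 / ε = 4 * (1 / ε) := by ring
  rw [this]
  nlinarith

lemma div_log_two_le {a : ℝ} (ha : 0 ≤ a) : a / Real.log 2 ≤ 2 * a := by
  rw [div_le_iff₀ (Real.log_pos one_lt_two)]
  nlinarith [Real.log_two_gt_d9]

/-- Upper bound in low dimension. -/
lemma exists_sketch_low_dim {n k : ℕ} {ε : ℝ} (hn : (100 : ℝ) ≤ n) (hk : 1 ≤ k)
    (hε : 0 < ε) (hε1 : ε ≤ 0.1) :
    ∃ b enc dec, IsDistanceSketch n k ε b enc dec ∧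
      (b : ℝ) ≤ 13 * (n * k * Real.log (1 / ε)) := by
  obtain ⟨b, enc, dec, h, hb⟩ := exists_sketch_of_fine_lattice (n := n) hk hε (by linarith)
  refine ⟨b, enc, dec, h, hb.trans ?_⟩
  have hk0 : (1 : ℝ) ≤ k := by exact_mod_cast hk
  set E := 1 / ε with hE
  have hE10 : 10 ≤ E := by rw [hE, le_div_iff₀ hε]; linarith
  rw [show 48 / ε = 48 * E by rw [hE]; ring, show 4 / ε = 4 * E by rw [hE]; ring]
  have he := Real.exp_one_lt_d9
  have he0 := Real.exp_pos 1
  have hL1 : 1 ≤ Real.log E := by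
    rw [Real.le_log_iff_exp_le (by linarith)]
    linarith
  have h1 : Real.log (Real.exp 1 * (3 + 48 * E)) ≤ 4 * Real.log E := by
    rw [← Nat.cast_ofNat (n := 4), ← Real.log_pow]
    refine Real.log_le_log (by positivity) ?_
    have hE3 : 10 ^ 3 ≤ E ^ 3 := pow_le_pow_left₀ (by norm_num) hE10 3
    have : Real.exp 1 * (3 + 48 * E) ≤ 3 * (3 + 48 * E) := by gcongr; linarith
    nlinarith
  have h2 : Real.log (1 + 4 * E) ≤ 2 * Real.log E := by
    rw [show 2 * Real.log E = Real.log (E ^ 2) by rw [Real.log_pow]; norm_num]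
    exact Real.log_le_log (by positivity) (by nlinarith)
  have h3 : 0 ≤ Real.log (1 + 4 * E) := Real.log_nonneg (by linarith)
  have h4 : 0 ≤ Real.log (Real.exp 1 * (3 + 48 * E)) :=
    Real.log_nonneg (by nlinarith [Real.add_one_le_exp 1])
  have hbound : k * Real.log (Real.exp 1 * (3 + 48 * E)) + Real.log (1 + 4 * E) ≤
      6 * (k * Real.log E) := by
    have h5 : k * Real.log (Real.exp 1 * (3 + 48 * E)) ≤ k * (4 * Real.log E) := by gcongr
    have h6 : Real.log E ≤ k * Real.log E := le_mul_of_one_le_left (by linarith) hk0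
    linarith
  have hone : 1 ≤ n * (k * Real.log E) := by
    have : 1 ≤ k * Real.log E := by nlinarith
    nlinarith
  have hdiv := div_log_two_le (a := n * (k * Real.log (Real.exp 1 * (3 + 48 * E)) +
    Real.log (1 + 4 * E))) (by positivity)
  have hmul := mul_le_mul_of_nonneg_left hbound (show (0 : ℝ) ≤ n by linarith)
  linarith

/-- Upper bound in intermediate dimension. -/
lemma exists_sketch_mid_dim {n k : ℕ} {ε : ℝ} (hn : (100 : ℝ) ≤ n)
    (hε : 0 < ε) (hε1 : ε ≤ 0.1) (hnε : 1 / (n : ℝ) ^ (0.49 : ℝ) ≤ ε)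
    (hk1 : Real.log n ≤ k) (hk2 : k ≤ Real.log n / ε ^ 2) :
    ∃ b enc dec, IsDistanceSketch n k ε b enc dec ∧
      (b : ℝ) ≤ 25 * (n * k * Real.log (2 + Real.log n / (ε ^ 2 * k))) := by
  have hl := four_le_log hn
  have hlog := log_one_add_four_div_le hn hε hnε
  set l := Real.log n with hl'
  have hk4 : (4 : ℝ) ≤ k := by linarith
  have hk0 : (0 : ℝ) < k := by linarith
  have hk : 1 ≤ k := by
    have : (1 : ℝ) ≤ k := by linarith
    exact_mod_cast this
  -- No dimension reduction is needed: the points are rounded in `ℝ^k` itself.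
  obtain ⟨b, enc, dec, h, hb⟩ := exists_sketch_of_coarse_lattice (n := n) (k := k) hn hk hε
    (by linarith) (hk2.trans (by rw [← hl']; gcongr; linarith)) fun x _ =>
      ⟨fun i l => x i l, fun i j => by rw [inner_eq_sum]; simp; positivity⟩
  refine ⟨b, enc, dec, h, ?_⟩
  rw [mul_div_assoc 442369] at hb
  refine hb.trans ?_
  set L := l / (ε ^ 2 * k) with hL
  have hL1 : 1 ≤ L := by
    rw [hL, le_div_iff₀ (by positivity), one_mul]
    rw [le_div_iff₀ (by positivity)] at hk2
    linarith
  have he := Real.exp_one_lt_d9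
  have he0 := Real.exp_pos 1
  have hone : 1 ≤ Real.log (2 + L) := by
    rw [Real.le_log_iff_exp_le (by linarith)]
    linarith
  have hsqrt : √(442369 * L) ≤ 666 * L := by
    rw [Real.sqrt_le_left (by positivity)]
    nlinarith
  have h1 : Real.log (Real.exp 1 * (3 + 4 * √(442369 * L))) ≤ 10 * Real.log (2 + L) := by
    rw [← Nat.cast_ofNat (n := 10), ← Real.log_pow]
    refine Real.log_le_log (by positivity) ?_
    have h9 : (3 : ℝ) ^ 9 ≤ (2 + L) ^ 9 := pow_le_pow_left₀ (by norm_num) (by linarith) 9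
    calc Real.exp 1 * (3 + 4 * √(442369 * L)) ≤ 3 * (3 + 4 * (666 * L)) := by
          gcongr
          linarith
      _ ≤ 3 ^ 9 * (2 + L) := by linarith
      _ ≤ (2 + L) ^ 9 * (2 + L) := by gcongr
      _ = _ := by ring
  have h4 : 0 ≤ Real.log (Real.exp 1 * (3 + 4 * √(442369 * L))) :=
    Real.log_nonneg (by nlinarith [Real.add_one_le_exp 1, Real.sqrt_nonneg (442369 * L)])
  have h3 : 0 ≤ Real.log (1 + 4 / ε) :=
    Real.log_nonneg (by linarith [show 0 < 4 / ε by positivity])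
  have hbound : k * Real.log (Real.exp 1 * (3 + 4 * √(442369 * L))) + Real.log (1 + 4 / ε) ≤
      12 * (k * Real.log (2 + L)) := by
    have h5 : k * Real.log (Real.exp 1 * (3 + 4 * √(442369 * L))) ≤
      k * (10 * Real.log (2 + L)) := by gcongr
    have h6 : (k : ℝ) ≤ k * Real.log (2 + L) := le_mul_of_one_le_right hk0.le hone
    linarith
  have hone' : 1 ≤ n * (k * Real.log (2 + L)) := by
    have : 1 ≤ k * Real.log (2 + L) := by nlinarith
    nlinarith
  have hdiv := div_log_two_le (a := n * (k * Real.log (Real.exp 1 * (3 + 4 * √(442369 * L))) +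
    Real.log (1 + 4 / ε))) (by positivity)
  have hmul := mul_le_mul_of_nonneg_left hbound (show (0 : ℝ) ≤ n by linarith)
  linarith

/-- Upper bound in arbitrary dimension. -/
lemma exists_sketch_high_dim {n : ℕ} (k : ℕ) {ε : ℝ} (hn : (100 : ℝ) ≤ n)
    (hε : 0 < ε) (hε1 : ε ≤ 0.1) (hnε : 1 / (n : ℝ) ^ (0.49 : ℝ) ≤ ε) :
    ∃ b enc dec, IsDistanceSketch n k ε b enc dec ∧
      (b : ℝ) ≤ 4000000 * (n * Real.log n / ε ^ 2) := by
  have hl := four_le_log hn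
  have hlog := log_one_add_four_div_le hn hε hnε
  set l := Real.log n with hl'
  have hl0 : 0 < l := by linarith
  have hM := hundred_le_one_div_sq hε hε1
  set G := l / ε ^ 2 with hG
  have hGl : l ≤ G := by
    have : G = l * (1 / ε ^ 2) := by rw [hG]; ring
    rw [this]
    exact le_mul_of_one_le_right hl0.le (by linarith)
  have hG0 : 0 < G := by linarith
  -- The ceiling costs at most `1 ≤ G`, whence `442369` in the coarse lattice. The ratio under the
  -- root is then bounded, so a coordinate costs a constant.
  set K := ⌈442368 * G⌉₊ with hK
  have hK1 : 442368 * G ≤ K := Nat.le_ceil _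
  have hK2 : (K : ℝ) ≤ 442369 * G := by
    have := (Nat.ceil_lt_add_one (show 0 ≤ 442368 * G by positivity)).le
    linarith
  have hKpos : 1 ≤ K := Nat.ceil_pos.2 (by positivity)
  have hK0 : (0 : ℝ) < K := by exact_mod_cast hKpos
  obtain ⟨b, enc, dec, h, hb⟩ := exists_sketch_of_coarse_lattice (n := n) (k := k) hn hKpos hε
    (by linarith) (by rw [mul_div_assoc]; exact hK2) fun x hx =>
      exists_dimension_reduction_log hn hε (by linarith) (by rw [mul_div_assoc]; exact hK1) x hx
  refine ⟨b, enc, dec, h, hb.trans ?_⟩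
  rw [← hl', mul_div_assoc (n : ℝ) l, ← hG]
  have hratio : 442369 * l / (ε ^ 2 * K) ≤ 2 ^ 2 := by
    have : 442369 * l / (ε ^ 2 * K) = 442369 * G / K := by rw [hG]; field_simp
    rw [this, div_le_iff₀ hK0]
    linarith
  have hsqrt := (Real.sqrt_le_sqrt hratio).trans_eq (Real.sqrt_sq zero_le_two)
  set Q := √(442369 * l / (ε ^ 2 * K)) with hQ
  have hQ0 : 0 ≤ Q := Real.sqrt_nonneg _
  have he := Real.exp_one_lt_d9
  have he1 := Real.exp_one_gt_d9
  have he0 := Real.exp_pos 1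
  have h1 : Real.log (Real.exp 1 * (3 + 4 * Q)) ≤ 4 := by
    rw [Real.log_le_iff_le_exp (by positivity)]
    have h4 : Real.exp 4 = Real.exp 1 * Real.exp 1 ^ 3 := by
      rw [← pow_succ', ← Real.exp_nat_mul]; norm_num
    have h3 : (2.5 : ℝ) ^ 3 ≤ Real.exp 1 ^ 3 := pow_le_pow_left₀ (by norm_num) (by linarith) 3
    rw [h4]
    gcongr
    linarith
  have h4 : 0 ≤ Real.log (Real.exp 1 * (3 + 4 * Q)) := Real.log_nonneg (by nlinarith)
  have h3 : 0 ≤ Real.log (1 + 4 / ε) :=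
    Real.log_nonneg (by linarith [show 0 < 4 / ε by positivity])
  have hbound : K * Real.log (Real.exp 1 * (3 + 4 * Q)) + Real.log (1 + 4 / ε) ≤
      1769478 * G := by
    have h5 : K * Real.log (Real.exp 1 * (3 + 4 * Q)) ≤ K * 4 := by gcongr
    linarith
  have hone : 1 ≤ n * G := by nlinarith
  have hdiv := div_log_two_le (a := n * (K * Real.log (Real.exp 1 * (3 + 4 * Q)) +
    Real.log (1 + 4 / ε))) (by positivity)
  have hmul := mul_le_mul_of_nonneg_left hbound (show (0 : ℝ) ≤ n by linarith)
  linarith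

/-! ### Assembling the theorem. -/

/-- The existing sketch also shows that the infimum is attained, ruling out the default value `0` of
`sInf ∅`. -/
lemma sketchBits_bounds {n k : ℕ} {ε lo hi : ℝ}
    (hup : ∃ b enc dec, IsDistanceSketch n k ε b enc dec ∧ (b : ℝ) ≤ hi)
    (hlo : ∀ b enc dec, IsDistanceSketch n k ε b enc dec → lo ≤ b) :
    lo ≤ sketchBits n k ε ∧ sketchBits n k ε ≤ hi := by
  obtain ⟨b, enc, dec, h, hb⟩ := hup
  have hne : {b : ℕ | ∃ enc dec, IsDistanceSketch n k ε b enc dec}.Nonempty :=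
    ⟨b, enc, dec, h⟩
  constructor
  · obtain ⟨enc', dec', h'⟩ := Nat.sInf_mem hne
    exact hlo _ enc' dec' h'
  · have hle : sketchBits n k ε ≤ b := Nat.sInf_le ⟨enc, dec, h⟩
    exact le_trans (by exact_mod_cast hle) hb

theorem theorem1p1 :
    ∃ c C : ℝ, 0 < c ∧ 0 < C ∧
      ∀ (n k : ℕ) (ε : ℝ), 1 ≤ n → 1 ≤ k →
        1 / (n : ℝ) ^ (0.49 : ℝ) ≤ ε → ε ≤ 0.1 →
        (Real.log n / ε ^ 2 ≤ k → k ≤ n →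
          c * (n * Real.log n / ε ^ 2) ≤ sketchBits n k ε ∧
          sketchBits n k ε ≤ C * (n * Real.log n / ε ^ 2)) ∧
        (Real.log n ≤ k → k ≤ Real.log n / ε ^ 2 →
          c * (n * k * Real.log (2 + Real.log n / (ε ^ 2 * k))) ≤ sketchBits n k ε ∧
          sketchBits n k ε ≤ C * (n * k * Real.log (2 + Real.log n / (ε ^ 2 * k)))) ∧
        (k ≤ Real.log n →
          c * (n * k * Real.log (1 / ε)) ≤ sketchBits n k ε ∧
          sketchBits n k ε ≤ C * (n * k * Real.log (1 / ε))) := by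
  refine ⟨1 / 409600, 4000000, by norm_num, by norm_num, fun n k ε hn1 hk hnε hε => ?_⟩
  have hn := hundred_le_of_accuracy hn1 hnε hε
  have h0 : 0 < ε := lt_of_lt_of_le (by positivity) hnε
  have hl := four_le_log hn
  have hl0 : 0 < Real.log n := by linarith
  have hM := hundred_le_one_div_sq h0 hε
  have hk0 : (0 : ℝ) < k := by exact_mod_cast hk
  refine ⟨fun hk1 _ => ?_, fun hk1 hk2 => ?_, fun hk1 => ?_⟩
  · refine sketchBits_bounds (exists_sketch_high_dim k hn h0 hε hnε) fun b enc dec hs => ?_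
    have hκ : Real.log n ≤ Real.log n / ε ^ 2 := by
      rw [← mul_one_div]
      exact le_mul_of_one_le_right hl0.le (by linarith)
    -- At `κ = log n/ε²` the logarithmic factor is `log 3 ≥ 1` and can be dropped.
    have h := hs.lower_bound_high_dim hn1 hnε hε hκ le_rfl hk1
    have h1 : Real.log n / (ε ^ 2 * (Real.log n / ε ^ 2)) = 1 := by field_simp
    rw [h1] at h
    have hone : 1 ≤ Real.log (2 + 1) := by
      rw [Real.le_log_iff_exp_le (by norm_num)]
      linarith [Real.exp_one_lt_d9]
    refine le_trans ?_ h
    rw [mul_div_assoc]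
    exact mul_le_mul_of_nonneg_left (le_mul_of_one_le_right (by positivity) hone) (by norm_num)
  · obtain ⟨b, enc, dec, h, hb⟩ := exists_sketch_mid_dim hn h0 hε hnε hk1 hk2
    refine sketchBits_bounds ⟨b, enc, dec, h, hb.trans ?_⟩ fun b enc dec hs =>
      hs.lower_bound_high_dim hn1 hnε hε hk1 hk2 le_rfl
    have : 0 ≤ Real.log (2 + Real.log n / (ε ^ 2 * k)) :=
      Real.log_nonneg (by linarith [show 0 < Real.log n / (ε ^ 2 * k) by positivity])
    gcongr
    norm_num
  · have hlog0 : 0 ≤ Real.log (1 / ε) := Real.log_nonneg (by rw [le_div_iff₀ h0]; linarith)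
    obtain ⟨b, enc, dec, h, hb⟩ := exists_sketch_low_dim hn hk h0 hε
    refine sketchBits_bounds ⟨b, enc, dec, h, hb.trans ?_⟩ fun b enc dec hs =>
      le_trans ?_ (hs.lower_bound_low_dim hn hk h0 hε hk1)
    · gcongr
      norm_num
    · gcongr
      norm_num
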